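/- **Definitions.** A *weighted bi-colored plane tree* is a finite tree embedded in the oriented plane, with vertex set $V=V^+\sqcup V^-$ (black and white vertices) such that every edge joins a black and a white vertex, together with a weight $\mathcal W(e)\in\mathbb Z_{>0}$ for every edge $e$. The embedding is considered up to orientation-preserving homeomorphism of the plane, that is, it is given by the cyclic counterclockwise order of the edges around each vertex. The weight of a vertex is the sum of the weights of the edges at it. A *labeled passport* is a pair $\Xi=(\Xi^+,\Xi^-)$ of finite multisets of labeled weights $K_k=(K,k)$, where $K\in\mathbb Z_{>0}$ and $k$ is a label; a weight written without label has label $0$, and $K^\lambda$ means that $K$ occurs $\lambda$ times. A *labeled* weighted bi-colored plane tree with passport $\Xi$ is a weighted bi-colored plane tree with bijections $V^\pm\to\Xi^\pm$ such that every vertex is sent to a labeled weight whose weight is the weight of the vertex. Two such trees are identified if some isomorphism of trees preserves the colors, the cyclic orders around the vertices, the weights of the edges and the labelings; $\mathrm{Tree}(\Xi)$ is the set of the resulting classes. The *filling* $\mathrm{Fill}(\Xi)$ replaces, in $\Xi^+$ and in $\Xi^-$, the $\lambda$ copies of each labeled weight $K_k$ of multiplicity $\lambda$ by the pairwise different labeled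 weights $K_{(k,1)},\dots,K_{(k,\lambda)}$. Put $\mathrm{FTree}(\Xi)=\mathrm{Tree}(\mathrm{Fill}(\Xi))$, let $p(\Xi)$ be the product of the factorials of the multiplicities of all distinct elements of $\Xi^+$ and of $\Xi^-$, and define $$G(1)=\frac{\#\mathrm{FTree}(\Xi)}{p(\Xi)} .$$ **Proposition 4.6.** Let $p>q\ge 1$ be integers, $g_0=\gcd(p,q)$, and $\Xi=(\Xi^+,\Xi^-)=(q^p,p^q)$, i.e. $p$ black vertices of weight $q$ and $q$ white vertices of weight $p$. Then $\mathrm{FTree}(\Xi)$ is finite and $$G(1)=\sum_{(n_1,\dots,n_{g_0})\in S_1}\mathcal C_1(n_1,\dots,n_{g_0}),\qquad S_1=\Big\{(n_1,\dots,n_{g_0})\in\mathbb Z_{\ge0}^{g_0}\ \Big|\ \sum_{j=1}^{g_0}j\,n_j=g_0\Big\},$$ where, with $n=\sum_{j=1}^{g_0}n_j$, $$\mathcal C_1(n_1,\dots,n_{g_0})=(-1)^{n-1}(p+q-1)^{n-2}\prod_{j=1}^{g_0}\frac1{n_j!}\left[\frac{\big(\frac{j(p+q)}{g_0}-1\big)!}{\big(\frac{jp}{g_0}\big)!\,\big(\frac{jq}{g_0}\big)!}\right]^{n_j}.$$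 -/

import Mathlib

/-- A labeled passport with labels in `S`: a pair of finite multisets of labeled weights
`K_k = (K, k)`, `K` a positive integer and `k ∈ S`. -/
structure LabeledPassport (S : Type) where
  /-- labeled weights of the black vertices -/
  pos : Multiset (ℕ+ × S)
  /-- labeled weights of the white vertices -/
  neg : Multiset (ℕ+ × S)

open Classical in
/-- The filling of a multiset of labeled weights: the `λ` copies of `K_k` are replaced by
`K_{(k,1)}, …, K_{(k,λ)}`. -/
noncomputable def fillMultiset {S : Type} (m : Multiset (ℕ+ × S)) : Multiset (ℕ+ × (S × ℕ)) :=
  m.toFinset.val.bind fun x =>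
    (Finset.Icc 1 (m.count x)).val.map fun s => (x.1, (x.2, s))

/-- The filling `Fill(Ξ)` of a labeled passport. -/
noncomputable def LabeledPassport.fill {S : Type} (Ξ : LabeledPassport S) :
    LabeledPassport (S × ℕ) where
  pos := fillMultiset Ξ.pos
  neg := fillMultiset Ξ.neg

open Classical in
/-- `p(Ξ) = ∏ λ_i! ∏ μ_j!`, the product of the factorials of all multiplicities. -/
noncomputable def LabeledPassport.multFactorial {S : Type} (Ξ : LabeledPassport S) : ℕ :=
  (∏ x ∈ Ξ.pos.toFinset, (Ξ.pos.count x).factorial) *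
    ∏ x ∈ Ξ.neg.toFinset, (Ξ.neg.count x).factorial

/-- A weighted bi-colored plane tree with set of black vertices `B` and set of white vertices `W`.

The embedding in the oriented plane is recorded by its rotation system: at every vertex the
counterclockwise cyclic order of the neighbors (which in a tree are the same thing as the
incident edges). A tree is connected with a single face, so every rotation system on it comes
from an embedding in the plane, and two embeddings are related by an orientation-preserving
homeomorphism of the plane exactly when their rotation systems are isomorphic. -/
structure WBPTree (B W : Type) where
  graph : SimpleGraph (B ⊕ W)
  isTree : graph.IsTree
  /-- every edge joins a black and a white vertex -/
  bipartite : graph ≤ completeBipartiteGraph B W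
  /-- the next neighbor of `v` in counterclockwise order -/
  rot : ∀ v : B ⊕ W, Equiv.Perm (graph.neighborSet v)
  /-- the neighbors of `v` form one single cycle -/
  rot_isCycleOn : ∀ v : B ⊕ W, (rot v).IsCycleOn Set.univ
  /-- the weight of an edge, extended by zero to the pairs that are not edges -/
  weight : B → W → ℕ
  weight_pos_iff : ∀ b w, 0 < weight b w ↔ graph.Adj (Sum.inl b) (Sum.inr w)

/-- The weight of a black vertex: the sum of the weights of the edges at it. -/
def WBPTree.wtPos {B W : Type} [Fintype W] (T : WBPTree B W) (b : B) : ℕ :=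
  ∑ w, T.weight b w

/-- The weight of a white vertex: the sum of the weights of the edges at it. -/
def WBPTree.wtNeg {B W : Type} [Fintype B] (T : WBPTree B W) (w : W) : ℕ :=
  ∑ b, T.weight b w

/-- A labeled weighted bi-colored plane tree with labeled passport `Ξ`: the labelings are
bijections from the sets of vertices to the multisets `Ξ⁺`, `Ξ⁻`, compatible with the weights
of the vertices. -/
structure LWBPTree {S : Type} (Ξ : LabeledPassport S) (B W : Type) [Fintype B] [Fintype W]
    extends WBPTree B W where
  labPos : B → ℕ+ × S
  labNeg : W → ℕ+ × S
  labPos_bij : Finset.univ.val.map labPos = Ξ.pos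
  labNeg_bij : Finset.univ.val.map labNeg = Ξ.neg
  labPos_wt : ∀ b, ((labPos b).1 : ℕ) = toWBPTree.wtPos b
  labNeg_wt : ∀ w, ((labNeg w).1 : ℕ) = toWBPTree.wtNeg w

/-- Two labeled trees are the same: there is an isomorphism of the underlying trees that
preserves the colors, the cyclic orders around the vertices (the orientation), the weights
and the labelings. -/
def LWBPTree.Same {S : Type} {Ξ : LabeledPassport S} {B W B' W' : Type}
    [Fintype B] [Fintype W] [Fintype B'] [Fintype W']
    (T : LWBPTree Ξ B W) (T' : LWBPTree Ξ B' W') : Prop :=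
  ∃ (φ : T.graph ≃g T'.graph) (f : B ≃ B') (g : W ≃ W'),
    (∀ b, φ (Sum.inl b) = Sum.inl (f b)) ∧
    (∀ w, φ (Sum.inr w) = Sum.inr (g w)) ∧
    (∀ (v : B ⊕ W) (u : T.graph.neighborSet v),
      T'.rot (φ v) (φ.mapNeighborSet v u) = φ.mapNeighborSet v (T.rot v u)) ∧
    (∀ b w, T'.weight (f b) (g w) = T.weight b w) ∧
    (∀ b, T'.labPos (f b) = T.labPos b) ∧
    (∀ w, T'.labNeg (g w) = T.labNeg w)

theorem LWBPTree.Same.refl {S : Type} {Ξ : LabeledPassport S} {B W : Type}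
    [Fintype B] [Fintype W] (T : LWBPTree Ξ B W) : T.Same T :=
  ⟨SimpleGraph.Iso.refl, Equiv.refl _, Equiv.refl _, fun _ => rfl, fun _ => rfl,
    fun _ _ => rfl, fun _ _ => rfl, fun _ => rfl, fun _ => rfl⟩

theorem LWBPTree.Same.trans {S : Type} {Ξ : LabeledPassport S} {B W B' W' B'' W'' : Type}
    [Fintype B] [Fintype W] [Fintype B'] [Fintype W'] [Fintype B''] [Fintype W'']
    {T : LWBPTree Ξ B W} {T' : LWBPTree Ξ B' W'} {T'' : LWBPTree Ξ B'' W''}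
    (h : T.Same T') (h' : T'.Same T'') : T.Same T'' := by
  obtain ⟨φ, f, g, hf, hg, hr, hw, hp, hn⟩ := h
  obtain ⟨φ', f', g', hf', hg', hr', hw', hp', hn'⟩ := h'
  refine ⟨φ.trans φ', f.trans f', g.trans g', fun b => ?_, fun w => ?_, fun v u => ?_,
    fun b w => ?_, fun b => ?_, fun w => ?_⟩
  · simp [hf, hf']
  · simp [hg, hg']
  · have h1 := hr' (φ v) (φ.mapNeighborSet v u)
    rw [hr v u] at h1
    exact h1
  · simp [hw, hw']
  · simp [hp, hp']
  · simp [hn, hn']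

theorem LWBPTree.Same.symm {S : Type} {Ξ : LabeledPassport S} {B W B' W' : Type}
    [Fintype B] [Fintype W] [Fintype B'] [Fintype W']
    {T : LWBPTree Ξ B W} {T' : LWBPTree Ξ B' W'} (h : T.Same T') : T'.Same T := by
  obtain ⟨φ, f, g, hf, hg, hr, hw, hp, hn⟩ := h
  refine ⟨φ.symm, f.symm, g.symm, fun b => ?_, fun w => ?_, fun v u => ?_,
    fun b w => ?_, fun b => ?_, fun w => ?_⟩
  · rw [RelIso.symm_apply_eq, hf]; simp
  · rw [RelIso.symm_apply_eq, hg]; simp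
  · obtain ⟨v, rfl⟩ := φ.surjective v
    obtain ⟨u, rfl⟩ := (φ.mapNeighborSet v).surjective u
    rw [hr]
    have key : ∀ (x : B ⊕ W) (hx : x = v) (y z : T.graph.neighborSet x)
        (y' : T.graph.neighborSet v), (y : B ⊕ W) = y' → (z : B ⊕ W) = T.rot v y' →
        T.rot x y = z := by
      rintro x rfl y z y' h1 h2
      have : y = y' := Subtype.ext h1
      subst this
      exact Subtype.ext h2.symm
    refine key _ (φ.symm_apply_apply v) _ _ u ?_ ?_
    · exact φ.symm_apply_apply _
    · exact φ.symm_apply_apply _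
  · simpa using (hw (f.symm b) (g.symm w)).symm
  · simpa using (hp (f.symm b)).symm
  · simpa using (hn (g.symm w)).symm

instance LWBPTree.setoid {S : Type} (Ξ : LabeledPassport S) (B W : Type)
    [Fintype B] [Fintype W] : Setoid (LWBPTree Ξ B W) where
  r := LWBPTree.Same
  iseqv := ⟨LWBPTree.Same.refl, LWBPTree.Same.symm, LWBPTree.Same.trans⟩

/-- `Tree(Ξ)`: the set of labeled weighted bi-colored plane trees with labeled passport `Ξ`,
where trees that are the same are identified. Such a tree has `#Ξ⁺` black and `#Ξ⁻` white
vertices, so these are taken to be `Fin #Ξ⁺` and `Fin #Ξ⁻`. -/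
def TreeClass {S : Type} (Ξ : LabeledPassport S) : Type :=
  Quotient (LWBPTree.setoid Ξ (Fin (Multiset.card Ξ.pos)) (Fin (Multiset.card Ξ.neg)))

/-- `FTree(Ξ) = Tree(Fill(Ξ))`. -/
def FTree {S : Type} (Ξ : LabeledPassport S) : Type := TreeClass Ξ.fill

/-- `G(1) = #FTree(Ξ) / p(Ξ)`. -/
noncomputable def GOne {S : Type} (Ξ : LabeledPassport S) : ℚ :=
  (Nat.card (FTree Ξ) : ℚ) / (Ξ.multFactorial : ℚ)

/-- The passport `(q^p, p^q)`: `p` black vertices of weight `q` and `q` white vertices of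
weight `p`, all with the default label `0`. -/
def pqPassport (p q : ℕ+) : LabeledPassport ℕ where
  pos := Multiset.replicate p (q, 0)
  neg := Multiset.replicate q (p, 0)

/-- The set `S₁` of types for `g₀ = g`: the vectors `(n_1, …, n_g)` of natural numbers with
`∑ j n_j = g`. The entry `n_j` is `n i` with `j = i + 1`. -/
def typesOne (g : ℕ) : Finset (Fin g → ℕ) :=
  (Fintype.piFinset fun _ : Fin g => Finset.range (g + 1)).filter
    fun n => ∑ i : Fin g, ((i : ℕ) + 1) * n i = g

/-- The bound `n_j ≤ g` in the definition of `typesOne` is no restriction. -/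
theorem mem_typesOne {g : ℕ} {n : Fin g → ℕ} :
    n ∈ typesOne g ↔ ∑ i : Fin g, ((i : ℕ) + 1) * n i = g := by
  simp only [typesOne, Finset.mem_filter, Fintype.mem_piFinset, Finset.mem_range,
    and_iff_right_iff_imp]
  intro h i
  have h1 : ((i : ℕ) + 1) * n i ≤ ∑ i : Fin g, ((i : ℕ) + 1) * n i :=
    Finset.single_le_sum (f := fun i : Fin g => ((i : ℕ) + 1) * n i)
      (fun _ _ => Nat.zero_le _) (Finset.mem_univ i)
  nlinarith [Nat.zero_le ((i : ℕ) * n i)]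

/-- The summand `C₁(n_1, …, n_g)`, with `g = gcd(p, q)`. The divisions by `g` are exact. -/
def COne (p q : ℕ) (n : Fin (Nat.gcd p q) → ℕ) : ℚ :=
  (-1 : ℚ) ^ ((∑ i, n i : ℕ) - 1 : ℤ) * ((p : ℚ) + q - 1) ^ ((∑ i, n i : ℕ) - 2 : ℤ) *
    ∏ i : Fin (Nat.gcd p q),
      (1 / ((n i).factorial : ℚ)) *
        (((((i : ℕ) + 1) * (p + q) / Nat.gcd p q - 1).factorial : ℚ) /
          (((((i : ℕ) + 1) * p / Nat.gcd p q).factorial : ℚ) *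
            ((((i : ℕ) + 1) * q / Nat.gcd p q).factorial : ℚ))) ^ n i

/-! After filling, all labels differ, so a tree has no nontrivial automorphism and `FTree` is in
bijection with the plane trees on fixed vertex sets. Such a tree has p+q-1 edges. Rooting it at an
edge, that is, at a corner of a black vertex, multiplies the count by p+q-1, and this rooted count
is computed by a recursion.

Edge weights are forced: deleting an edge splits the tree into two parts, and the excess (black
minus white weight) of a part is, up to sign, the weight of that edge. So call a tree planted if a
corner is marked at a vertex of the heavier color (black in the balanced case) and the root alone
may fall short of its prescribed weight. A planted tree is a single vertex or arises uniquely by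
joining, at their marked corners, a planted tree of positive excess and one of negative excess.

Let U, D, H be the series in x, y, exponential in both variables, of the planted trees with
positive, negative and zero excess. The recursion says U + D + H = x + y + UD, that is, (1-U)(1-D) =
1 + H - (x+y), a Wiener-Hopf factorization (`plantedPart_factorization`). In its logarithmic Euler
derivative the terms of U and D are supported strictly on the two sides of the line of zero excess,
so on that line only H survives. Write (p,q) = g₀(a,b), s = a+b, and let P be 1 + H read along the
ray of (a,b). Then (`ray_planted_equation`) B(X/P^s) · (1 - s X P'/P) = 1, where B = ∑ binom(sj, aj)
X^j.

With F = ∑_{j≥1} (sj-1)!/((aj)!(bj)!) X^j one has B = 1 + s X F', and the equation is the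
differentiated form of P = exp(F(X/P^s)). Lagrange inversion (`coeff_of_subst_kernel`) gives
(1-sm)[X^m]P = [X^m] exp(-(sm-1)F). At m = g₀, where sm = p+q, expanding the exponential produces
the sum over S₁. Finally p! q! [X^g₀]P is the edge-rooted count (`plantedCount_eq_plantedCoeff`,
`plantedCount_of_balanced`). -/

/-! ### The operator X d/dX on power series. -/

open PowerSeries in
theorem PowerSeries.coeff_X_mul_derivative (f : ℚ⟦X⟧) (n : ℕ) :
    coeff n (X * d⁄dX ℚ f) = n * coeff n f := by
  cases n with
  | zero => simp
  | succ n => rw [coeff_succ_X_mul, coeff_derivative]; push_cast; ring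

open PowerSeries in
theorem PowerSeries.eq_of_X_mul_derivative_eq {f g : ℚ⟦X⟧}
    (h : X * d⁄dX ℚ f = X * d⁄dX ℚ g) (h0 : constantCoeff f = constantCoeff g) : f = g := by
  ext n
  rcases Nat.eq_zero_or_pos n with rfl | hn
  · simpa using h0
  · have := congrArg (coeff n) h
    rw [coeff_X_mul_derivative, coeff_X_mul_derivative] at this
    have hn' : (n : ℚ) ≠ 0 := by positivity
    exact mul_left_cancel₀ hn' this

/-! ### Lagrange inversion for y = X / P^s. -/

section Lagrange
open PowerSeries

variable {P : ℚ⟦X⟧}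

theorem isUnit_series (hP : constantCoeff P = 1) : P * P⁻¹ = 1 :=
  PowerSeries.mul_inv_cancel _ (by rw [hP]; exact one_ne_zero)

theorem hasSubst_X_mul (f : ℚ⟦X⟧) : HasSubst (X * f : ℚ⟦X⟧) :=
  HasSubst.of_constantCoeff_zero' (by simp)

theorem X_mul_derivative_pow (f : ℚ⟦X⟧) (k : ℕ) (hf : f * f⁻¹ = 1) :
    X * d⁄dX ℚ (f ^ k) = (k : ℚ⟦X⟧) * f ^ k * (X * d⁄dX ℚ f * f⁻¹) := by
  rw [derivative_pow]
  cases k with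
  | zero => simp
  | succ k =>
    rw [Nat.add_sub_cancel, pow_succ]
    linear_combination (-((k + 1 : ℕ) : ℚ⟦X⟧) * X * f ^ k * d⁄dX ℚ f) * hf

/-- Logarithmic differentiation of y = X / P^s. The factor 1 - s X P'/P is the Jacobian of the
substitution and recurs below as the kernel. -/
theorem X_mul_derivative_kernel (hP : constantCoeff P = 1) (s : ℕ) :
    X * d⁄dX ℚ (X * P⁻¹ ^ s) =
      X * P⁻¹ ^ s * (1 - (s : ℚ⟦X⟧) * (X * d⁄dX ℚ P * P⁻¹)) := by
  have h := isUnit_series hP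
  rw [Derivation.leibniz, derivative_X, derivative_pow, derivative_inv', smul_eq_mul, smul_eq_mul,
    mul_one]
  cases s with
  | zero => simp
  | succ s =>
    rw [Nat.add_sub_cancel]
    ring

/-- A residue computation. -/
theorem coeff_pow_mul_kernel (hP : constantCoeff P = 1) (s n : ℕ) :
    coeff n (P ^ (s * n) * (1 - (s : ℚ⟦X⟧) * (X * d⁄dX ℚ P * P⁻¹))) =
      if n = 0 then 1 else 0 := by
  have h := isUnit_series hP
  split_ifs with hn
  · subst hn; simp
  · have hn' : (n : ℚ) ≠ 0 := by exact_mod_cast hn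
    -- For any series f, the coefficient of X^n in n f - X f' vanishes; here f = P^(sn).
    have e : (C (n : ℚ)) * (P ^ (s * n) * (1 - (s : ℚ⟦X⟧) * (X * d⁄dX ℚ P * P⁻¹))) =
        C (n : ℚ) * P ^ (s * n) - X * d⁄dX ℚ (P ^ (s * n)) := by
      rw [X_mul_derivative_pow _ _ h]; push_cast; simp; ring
    have := congrArg (coeff n) e
    rw [coeff_C_mul, map_sub, coeff_C_mul, coeff_X_mul_derivative, sub_self] at this
    exact (mul_eq_zero.mp this).resolve_left hn'

/-- Lagrange inversion for the substitution `y = X / P ^ s`. -/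
theorem coeff_subst_mul_kernel (hP : constantCoeff P = 1) (s m : ℕ) (f : ℚ⟦X⟧) :
    coeff m (f.subst (X * P⁻¹ ^ s : ℚ⟦X⟧) * P ^ (s * m) *
      (1 - (s : ℚ⟦X⟧) * (X * d⁄dX ℚ P * P⁻¹))) = coeff m f := by
  have h := isUnit_series hP
  set y : ℚ⟦X⟧ := X * P⁻¹ ^ s with hy
  have hs : HasSubst y := hasSubst_X_mul _
  have key : ∀ j ≤ m, y ^ j * P ^ (s * m) = X ^ j * P ^ (s * (m - j)) := by
    intro j hj
    obtain ⟨k, rfl⟩ := Nat.exists_eq_add_of_le hj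
    have : P⁻¹ ^ (s * j) * P ^ (s * j) = 1 := by
      rw [← mul_pow, mul_comm, h, one_pow]
    rw [hy, mul_pow, ← pow_mul, mul_add, pow_add, Nat.add_sub_cancel_left]
    linear_combination (X ^ j * P ^ (s * k)) * this
  have mono : ∀ j ≤ m, coeff m (y ^ j * P ^ (s * m) *
      (1 - (s : ℚ⟦X⟧) * (X * d⁄dX ℚ P * P⁻¹))) = if j = m then 1 else 0 := by
    intro j hj
    rw [key j hj, mul_assoc, coeff_X_pow_mul', if_pos hj, coeff_pow_mul_kernel hP]
    congr 1
    simp only [eq_iff_iff]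
    omega
  -- Split f after degree m: the tail becomes divisible by y^(m+1), hence by X^(m+1), and cannot
  -- reach the coefficient of X^m. The rest is a finite sum of monomials.
  have hf : f = X ^ (m + 1) * (mk fun i => coeff (i + (m + 1)) f) +
      ∑ j ∈ Finset.range (m + 1), coeff j f • X ^ j := by
    ext n
    rw [map_add, map_sum, coeff_X_pow_mul']
    simp only [coeff_smul, coeff_X_pow, smul_eq_mul, mul_ite, mul_one, mul_zero,
      Finset.sum_ite_eq, Finset.mem_range, coeff_mk]
    split_ifs with h1 h2
    · omega
    · simp [Nat.sub_add_cancel h1]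
    · simp
    · omega
  have hsub : f.subst y = y ^ (m + 1) * (mk fun i => coeff (i + (m + 1)) f : ℚ⟦X⟧).subst y +
      ∑ j ∈ Finset.range (m + 1), coeff j f • y ^ j := by
    conv_lhs => rw [hf]
    rw [← coe_substAlgHom hs]
    simp only [map_add, map_mul, map_sum, map_pow, map_smul, substAlgHom_X]
  have z : coeff m (y ^ (m + 1) * (mk fun i => coeff (i + (m + 1)) f : ℚ⟦X⟧).subst y *
      P ^ (s * m) * (1 - (s : ℚ⟦X⟧) * (X * d⁄dX ℚ P * P⁻¹))) = 0 := by
    rw [hy, mul_pow, mul_assoc, mul_assoc, mul_assoc, coeff_X_pow_mul', if_neg (by omega)]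
  rw [hsub, add_mul, add_mul, map_add, z, zero_add, Finset.sum_mul, Finset.sum_mul, map_sum]
  rw [Finset.sum_eq_single m]
  · rw [smul_mul_assoc, smul_mul_assoc, coeff_smul, mono m le_rfl]; simp
  · intro j hj hne
    rw [smul_mul_assoc, smul_mul_assoc, coeff_smul, mono j (by simpa [Nat.lt_succ_iff] using hj)]
    simp [hne]
  · simp

/-- Solutions of first order linear differential equations are determined, up to a given order,
by the equation up to that order. -/
theorem coeff_eq_of_linear_ode {A A' F G : ℚ⟦X⟧} {m : ℕ} (hF : X * d⁄dX ℚ F = A * F)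
    (hG : X * d⁄dX ℚ G = A' * G) (hA : constantCoeff A = 0)
    (hAA : ∀ n ≤ m, coeff n A = coeff n A') (h0 : constantCoeff F = constantCoeff G) :
    ∀ n ≤ m, coeff n F = coeff n G := by
  intro n
  induction n using Nat.strong_induction_on with
  | _ n ih =>
    intro hn
    rcases Nat.eq_zero_or_pos n with rfl | hpos
    · simpa using h0
    have e1 := congrArg (coeff n) hF
    have e2 := congrArg (coeff n) hG
    rw [coeff_X_mul_derivative, coeff_mul] at e1 e2
    have hn' : (n : ℚ) ≠ 0 := by positivity
    apply mul_left_cancel₀ hn'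
    rw [e1, e2]
    refine Finset.sum_congr rfl fun x hx => ?_
    have hx := Finset.HasAntidiagonal.mem_antidiagonal.mp hx
    rw [← hAA x.1 (by omega)]
    rcases Nat.eq_zero_or_pos x.1 with h | h
    · rw [h, coeff_zero_eq_constantCoeff_apply, hA]; simp
    · rw [ih x.2 (by omega) (by omega)]

/-- `exp (d X ^ (k + 1))` -/
noncomputable def expMonomial (d : ℚ) (k : ℕ) : ℚ⟦X⟧ :=
  (rescale d (exp ℚ)).subst (X ^ (k + 1) : ℚ⟦X⟧)

theorem coeff_expMonomial (d : ℚ) (k n : ℕ) :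
    coeff n (expMonomial d k) =
      if (k + 1) ∣ n then d ^ (n / (k + 1)) / ((n / (k + 1)).factorial : ℚ) else 0 := by
  rw [expMonomial, coeff_subst_X_pow (Nat.succ_ne_zero k)]
  simp [coeff_rescale, coeff_exp, div_eq_mul_inv]

theorem X_mul_derivative_expMonomial (d : ℚ) (k : ℕ) :
    X * d⁄dX ℚ (expMonomial d k) = C (d * (k + 1)) * X ^ (k + 1) * expMonomial d k := by
  have h : d⁄dX ℚ (rescale d (exp ℚ)) = d • rescale d (exp ℚ) := by
    ext n
    have : ((n : ℚ) + 1) ≠ 0 := by positivity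
    rw [coeff_derivative, coeff_smul, coeff_rescale, coeff_rescale, coeff_exp, coeff_exp]
    simp only [Nat.factorial_succ, eq_ratCast, Rat.cast_id, smul_eq_mul]
    push_cast
    field_simp
    ring
  have hs : HasSubst (X ^ (k + 1) : ℚ⟦X⟧) := HasSubst.X_pow (Nat.succ_ne_zero k)
  rw [expMonomial, derivative_subst hs, h, subst_smul hs, derivative_pow, derivative_X]
  rw [smul_eq_C_mul, map_mul, Nat.add_sub_cancel]
  push_cast
  simp only [map_add, map_natCast, map_one]
  ring

theorem X_mul_derivative_prod_expMonomial {m : ℕ} (d : Fin m → ℚ) :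
    X * d⁄dX ℚ (∏ i, expMonomial (d i) i) =
      (∑ i : Fin m, C (d i * ((i : ℕ) + 1)) * X ^ ((i : ℕ) + 1)) *
        ∏ i, expMonomial (d i) i := by
  induction (Finset.univ : Finset (Fin m)) using Finset.induction_on with
  | empty => simp
  | insert a s ha ih =>
    rw [Finset.prod_insert ha, Finset.sum_insert ha, Derivation.leibniz, smul_eq_mul, smul_eq_mul]
    linear_combination expMonomial (d a) a * ih +
      (∏ i ∈ s, expMonomial (d i) i) * X_mul_derivative_expMonomial (d a) a

/-- The i-th factor contains only powers of X^(i+1). Hence a splitting of the exponent m contributes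
only if its i-th entry is divisible by i+1, and the quotients form a type. -/
theorem coeff_prod_expMonomial {m : ℕ} (d : Fin m → ℚ) :
    coeff m (∏ i, expMonomial (d i) i) =
      ∑ n ∈ typesOne m, ∏ i, (1 / ((n i).factorial : ℚ)) * d i ^ n i := by
  classical
  rw [coeff_prod]
  rw [← Finset.sum_filter_add_sum_filter_not (Finset.finsuppAntidiag _ _)
    (fun l : Fin m →₀ ℕ => ∀ i : Fin m, ((i : ℕ) + 1) ∣ l i)]
  rw [add_comm]
  refine (congrArg₂ (· + ·) (Finset.sum_eq_zero ?_) rfl).trans ?_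
  rotate_left
  · rw [zero_add]
    symm
    refine Finset.sum_bij' (fun n _ => Finsupp.equivFunOnFinite.symm fun i => ((i : ℕ) + 1) * n i)
      (fun l _ i => l i / ((i : ℕ) + 1)) ?_ ?_ ?_ ?_ ?_
    · intro n hn
      rw [mem_typesOne] at hn
      simp [Finset.mem_finsuppAntidiag, hn]
    · intro l hl
      rw [Finset.mem_filter, Finset.mem_finsuppAntidiag] at hl
      rw [mem_typesOne]
      refine Eq.trans ?_ hl.1.1
      refine Finset.sum_congr rfl fun i _ => ?_
      exact Nat.mul_div_cancel' (hl.2 i)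
    · intro n hn
      funext i
      simp
    · intro l hl
      ext i
      simpa using Nat.mul_div_cancel' ((Finset.mem_filter.mp hl).2 i)
    · intro n hn
      refine Finset.prod_congr rfl fun i _ => ?_
      rw [coeff_expMonomial]
      simp [div_eq_mul_inv, mul_comm]
  · intro l hl
    obtain ⟨i, hi⟩ := not_forall.mp (Finset.mem_filter.mp hl).2
    refine Finset.prod_eq_zero (Finset.mem_univ i) ?_
    rw [coeff_expMonomial, if_neg hi]

theorem constantCoeff_subst_eq_one {a f : ℚ⟦X⟧} (ha : constantCoeff a = 0)
    (hf : constantCoeff f = 1) : constantCoeff (f.subst a : ℚ⟦X⟧) = 1 := by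
  have hs : HasSubst a := HasSubst.of_constantCoeff_zero' ha
  have h2 : constantCoeff ((f - 1).subst a : ℚ⟦X⟧) = 0 :=
    constantCoeff_subst_eq_zero ha (f - 1) (by simp [hf])
  rw [← coe_substAlgHom hs, map_sub, map_one, map_sub, map_one, coe_substAlgHom hs] at h2
  linarith

/-- The coefficients of the solution `P` of `P = exp (F (X / P ^ s))`, where the equation is
given in its differentiated form. -/
theorem coeff_of_subst_kernel (hP : constantCoeff P = 1) {s : ℕ} (hs : 0 < s) {F B : ℚ⟦X⟧}
    (hF : constantCoeff F = 0) (hB : B = 1 + (s : ℚ⟦X⟧) * (X * d⁄dX ℚ F))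
    (h : B.subst (X * P⁻¹ ^ s : ℚ⟦X⟧) * (1 - (s : ℚ⟦X⟧) * (X * d⁄dX ℚ P * P⁻¹)) = 1)
    {m : ℕ} (hm : 0 < m) :
    (1 - (s * m : ℚ)) * coeff m P =
      ∑ n ∈ typesOne m, ∏ i : Fin m,
        (1 / ((n i).factorial : ℚ)) * (-(s * m - 1 : ℚ) * coeff ((i : ℕ) + 1) F) ^ n i := by
  have hPP := isUnit_series hP
  -- The exponent k = sm - 1 makes E = exp(-kF) the right test series: E(y) P^k = 1, so E(y) P^(sm)
  -- collapses to P.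
  obtain ⟨k, hk⟩ : ∃ k, s * m = k + 1 := ⟨s * m - 1, by have := Nat.mul_pos hs hm; omega⟩
  have hkq : (s * m - 1 : ℚ) = k := by
    have : (s * m : ℚ) = k + 1 := by exact_mod_cast hk
    rw [this]; ring
  rw [hkq]
  have hsk : HasSubst (C (-(k : ℚ)) * F : ℚ⟦X⟧) := HasSubst.of_constantCoeff_zero' (by simp [hF])
  set E : ℚ⟦X⟧ := (exp ℚ).subst (C (-(k : ℚ)) * F : ℚ⟦X⟧) with hE
  have hE' : X * d⁄dX ℚ E = (C (-(k : ℚ)) * (X * d⁄dX ℚ F)) * E := by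
    rw [hE, derivative_subst hsk, derivative_exp, Derivation.leibniz, derivative_C]
    simp only [smul_eq_mul]
    ring
  have hE0 : constantCoeff E = 1 := constantCoeff_subst_eq_one (by simp [hF]) (by simp)
  set y : ℚ⟦X⟧ := X * P⁻¹ ^ s with hy
  have hsy : HasSubst y := hasSubst_X_mul _
  set δ : ℚ⟦X⟧ := 1 - (s : ℚ⟦X⟧) * (X * d⁄dX ℚ P * P⁻¹) with hδ
  have hyδ : X * d⁄dX ℚ y = y * δ := X_mul_derivative_kernel hP s
  have hFy : (s : ℚ⟦X⟧) * (X * d⁄dX ℚ F).subst y = B.subst y - 1 := by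
    rw [hB, ← coe_substAlgHom hsy]; simp
  have hEy : X * d⁄dX ℚ (E.subst y) = (X * d⁄dX ℚ E).subst y * δ := by
    rw [derivative_subst hsy, subst_mul hsy, subst_X hsy]
    linear_combination (d⁄dX ℚ E).subst y * hyδ
  have hEy2 : (s : ℚ⟦X⟧) * (X * d⁄dX ℚ (E.subst y)) =
      -(k : ℚ⟦X⟧) * E.subst y * (1 - δ) := by
    have h1 : (X * d⁄dX ℚ E).subst y =
        -(k : ℚ⟦X⟧) * (X * d⁄dX ℚ F).subst y * E.subst y := by
      rw [hE', ← coe_substAlgHom hsy]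
      have : (C (-(k : ℚ)) : ℚ⟦X⟧) = -(k : ℚ⟦X⟧) := by simp
      rw [this]; simp
    rw [hEy, h1]
    linear_combination (-(k : ℚ⟦X⟧) * E.subst y * δ) * hFy + (-(k : ℚ⟦X⟧) * E.subst y) * h
  -- This is P = exp(F(y)) raised to the power -k. Both sides have constant term 1, and the
  -- logarithmic derivatives of the two factors cancel; multiplying by the nonzero s allows `h` to
  -- be used.
  have hone : E.subst y * P ^ k = 1 := by
    apply eq_of_X_mul_derivative_eq
    · rw [Derivation.map_one_eq_zero, mul_zero]
      have hs' : (s : ℚ⟦X⟧) ≠ 0 := by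
        intro h0
        have := congrArg constantCoeff h0
        rw [map_natCast, map_zero, Nat.cast_eq_zero] at this
        omega
      apply mul_left_cancel₀ hs'
      rw [Derivation.leibniz, smul_eq_mul, smul_eq_mul]
      have h2 := X_mul_derivative_pow P k hPP
      linear_combination P ^ k * hEy2 + s * E.subst y * h2 + (-(k : ℚ⟦X⟧) * E.subst y * P ^ k) * hδ
    · rw [map_mul, map_pow, hP, constantCoeff_subst_eq_one (by simp [hy]) hE0]; simp
  have hl := coeff_subst_mul_kernel hP s m E
  rw [← hy, ← hδ, hk, pow_succ, ← mul_assoc, hone, one_mul] at hl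
  have hPδ : P * δ = P - C (s : ℚ) * (X * d⁄dX ℚ P) := by
    rw [hδ]; simp only [map_natCast]
    linear_combination (-(s : ℚ⟦X⟧) * X * d⁄dX ℚ P) * hPP
  rw [hPδ, map_sub, coeff_C_mul, coeff_X_mul_derivative] at hl
  -- Only the coefficients of F up to degree m matter, so exp(-kF) may be replaced by the finite
  -- product of the exponentials of its monomials.
  have hcmp := coeff_eq_of_linear_ode (m := m) hE'
    (X_mul_derivative_prod_expMonomial (m := m) fun i => -(k : ℚ) * coeff ((i : ℕ) + 1) F)
    (by simp) ?_ ?_ m le_rfl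
  · rw [← coeff_prod_expMonomial, ← hcmp, ← hl]; ring
  · intro n hn
    rw [coeff_C_mul, coeff_X_mul_derivative, map_sum]
    simp only [coeff_C_mul, coeff_X_pow]
    rcases Nat.eq_zero_or_pos n with rfl | hpos
    · simp
    · rw [Finset.sum_eq_single (⟨n - 1, by omega⟩ : Fin m)]
      · simp only [Nat.sub_add_cancel hpos, if_true]
        have : ((n - 1 : ℕ) : ℚ) + 1 = n := by exact_mod_cast Nat.sub_add_cancel hpos
        rw [this]; ring
      · intro i _ hi
        rw [if_neg, mul_zero]
        rintro rfl
        exact hi (Fin.ext (by simp))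
      · simp
  · rw [hE0, map_prod, Finset.prod_eq_one]
    intro i _
    rw [← coeff_zero_eq_constantCoeff_apply, coeff_expMonomial]; simp

end Lagrange

/-! ### The Wiener-Hopf factorization in two variables. -/

section Bivariate
open MvPowerSeries

/-- A series all of whose exponents have nonnegative value under `e`. -/
def NonnegSupp (e : (Fin 2 →₀ ℕ) →+ ℤ) (f : MvPowerSeries (Fin 2) ℚ) : Prop :=
  ∀ d, e d < 0 → coeff d f = 0

/-- A series all of whose exponents have positive value under `e`. -/
def PosSupp (e : (Fin 2 →₀ ℕ) →+ ℤ) (f : MvPowerSeries (Fin 2) ℚ) : Prop :=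
  ∀ d, e d ≤ 0 → coeff d f = 0

variable {e : (Fin 2 →₀ ℕ) →+ ℤ} {f g : MvPowerSeries (Fin 2) ℚ}

theorem PosSupp.nonneg (hf : PosSupp e f) : NonnegSupp e f := fun d hd => hf d hd.le

theorem PosSupp.mul_nonneg (hf : PosSupp e f) (hg : NonnegSupp e g) : PosSupp e (f * g) := by
  classical
  intro d hd
  rw [coeff_mul]
  refine Finset.sum_eq_zero fun x hx => ?_
  have hx : x.1 + x.2 = d := Finset.HasAntidiagonal.mem_antidiagonal.mp hx
  rw [← hx, map_add] at hd
  by_cases h : e x.1 ≤ 0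
  · rw [hf _ h, zero_mul]
  · rw [hg x.2 (by omega), mul_zero]

theorem size_add {d d₁ d₂ : Fin 2 →₀ ℕ} (h : d₁ + d₂ = d) :
    d 0 + d 1 = (d₁ 0 + d₁ 1) + (d₂ 0 + d₂ 1) := by
  rw [← h, Finsupp.add_apply, Finsupp.add_apply]; ring

theorem size_pos {d : Fin 2 →₀ ℕ} (h : d ≠ 0) : 0 < d 0 + d 1 := by
  by_contra hc
  apply h
  ext i
  fin_cases i
  · simp; omega
  · simp; omega

/-- The inverse of 1 - f is a geometric series in f, and exponents of nonnegative value are closed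
under addition. Formally, g = 1 + f g is used by induction on the total degree. -/
theorem NonnegSupp.of_mul_one_sub (hf : NonnegSupp e f) (h0 : coeff 0 f = 0)
    (hg : g * (1 - f) = 1) : NonnegSupp e g := by
  classical
  have hg' : g = 1 + f * g := by linear_combination hg
  have key : ∀ n, ∀ d : Fin 2 →₀ ℕ, d 0 + d 1 = n → e d < 0 → coeff d g = 0 := by
    intro n
    induction n using Nat.strong_induction_on with
    | _ n ih =>
      intro d hn hd
      have hd0 : d ≠ 0 := by rintro rfl; simp at hd
      rw [hg', map_add, coeff_one, if_neg hd0, zero_add, coeff_mul]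
      refine Finset.sum_eq_zero fun x hx => ?_
      have hx : x.1 + x.2 = d := Finset.HasAntidiagonal.mem_antidiagonal.mp hx
      by_cases h : e x.1 < 0
      · rw [hf _ h, zero_mul]
      by_cases h1 : x.1 = 0
      · rw [h1, h0, zero_mul]
      · have := size_add hx
        have := size_pos h1
        rw [← hx, map_add] at hd
        rw [ih (x.2 0 + x.2 1) (by omega) x.2 rfl (by omega), mul_zero]
  exact fun d => key _ d rfl

/-- The Euler derivation. -/
noncomputable def euler (f : MvPowerSeries (Fin 2) ℚ) : MvPowerSeries (Fin 2) ℚ :=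
  fun d => ((d 0 + d 1 : ℕ) : ℚ) * coeff d f

theorem coeff_euler (f : MvPowerSeries (Fin 2) ℚ) (d : Fin 2 →₀ ℕ) :
    coeff d (euler f) = ((d 0 + d 1 : ℕ) : ℚ) * coeff d f := rfl

theorem euler_mul (f g : MvPowerSeries (Fin 2) ℚ) :
    euler (f * g) = euler f * g + f * euler g := by
  classical
  ext d
  rw [coeff_euler, map_add, coeff_mul, coeff_mul, coeff_mul, Finset.mul_sum,
    ← Finset.sum_add_distrib]
  refine Finset.sum_congr rfl fun x hx => ?_
  rw [size_add (Finset.HasAntidiagonal.mem_antidiagonal.mp hx), coeff_euler, coeff_euler]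
  push_cast
  ring

theorem euler_add (f g : MvPowerSeries (Fin 2) ℚ) : euler (f + g) = euler f + euler g := by
  ext d; simp only [coeff_euler, map_add]; ring

theorem euler_sub (f g : MvPowerSeries (Fin 2) ℚ) : euler (f - g) = euler f - euler g := by
  ext d; simp only [coeff_euler, map_sub]; ring

theorem euler_one : euler 1 = 0 := by
  classical
  ext d
  rw [coeff_euler, coeff_one]
  split_ifs with h
  · simp [h]
  · simp

theorem euler_X (i : Fin 2) : euler (X i) = X i := by
  classical
  ext d
  rw [coeff_euler, coeff_X]
  split_ifs with h
  · subst h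
    fin_cases i <;> simp
  · simp

theorem PosSupp.euler (hf : PosSupp e f) : PosSupp e (euler f) := by
  intro d hd
  rw [coeff_euler, hf d hd, mul_zero]

theorem coeff_X_add_X_pow (k : ℕ) (d : Fin 2 →₀ ℕ) :
    coeff d ((X 0 + X 1 : MvPowerSeries (Fin 2) ℚ) ^ k) =
      if d 0 + d 1 = k then ((d 0 + d 1).choose (d 0) : ℚ) else 0 := by
  have hs : PowerSeries.HasSubst (X 0 + X 1 : MvPowerSeries (Fin 2) ℚ) :=
    PowerSeries.HasSubst.of_constantCoeff_zero (by simp)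
  have := PowerSeries.coeff_subst_X_zero_add_X_one (PowerSeries.X ^ k : PowerSeries ℚ) d
  rw [PowerSeries.subst_pow hs, PowerSeries.subst_X hs] at this
  rw [this, PowerSeries.coeff_X_pow]
  split_ifs <;> simp

theorem coeff_X_add_X_pow_mul {N : ℕ} {d : Fin 2 →₀ ℕ} (hd : d 0 + d 1 < N)
    (f : MvPowerSeries (Fin 2) ℚ) : coeff d ((X 0 + X 1) ^ N * f) = 0 := by
  classical
  rw [coeff_mul]
  refine Finset.sum_eq_zero fun x hx => ?_
  have := size_add (Finset.HasAntidiagonal.mem_antidiagonal.mp hx)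
  rw [coeff_X_add_X_pow, if_neg (by omega), zero_mul]

/-- The exponent `j (a, b)`. -/
noncomputable def rayExp (a b j : ℕ) : Fin 2 →₀ ℕ :=
  Finsupp.single 0 (a * j) + Finsupp.single 1 (b * j)

@[simp] theorem rayExp_zero (a b j : ℕ) : rayExp a b j 0 = a * j := by simp [rayExp]

@[simp] theorem rayExp_one (a b j : ℕ) : rayExp a b j 1 = b * j := by simp [rayExp]

theorem exp_ext {d d' : Fin 2 →₀ ℕ} (h0 : d 0 = d' 0) (h1 : d 1 = d' 1) : d = d' := by
  ext i; fin_cases i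
  · exact h0
  · exact h1

theorem rayExp_add (a b i j : ℕ) : rayExp a b i + rayExp a b j = rayExp a b (i + j) :=
  exp_ext (by simp; ring) (by simp; ring)

theorem rayExp_injective {a : ℕ} (ha : 0 < a) (b : ℕ) : Function.Injective (rayExp a b) := by
  intro i j h
  have := DFunLike.congr_fun h 0
  simp only [rayExp_zero] at this
  exact Nat.eq_of_mul_eq_mul_left ha this

/-- The series of the coefficients along the ray spanned by `(a, b)`. -/
noncomputable def ray (a b : ℕ) (f : MvPowerSeries (Fin 2) ℚ) : PowerSeries ℚ :=
  PowerSeries.mk fun j => coeff (rayExp a b j) f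

theorem coeff_ray (a b j : ℕ) (f : MvPowerSeries (Fin 2) ℚ) :
    PowerSeries.coeff j (ray a b f) = coeff (rayExp a b j) f := PowerSeries.coeff_mk _ _

theorem ray_add (a b : ℕ) (f g : MvPowerSeries (Fin 2) ℚ) :
    ray a b (f + g) = ray a b f + ray a b g := by
  ext j; simp [coeff_ray]

theorem ray_sum (a b : ℕ) {ι : Type*} (S : Finset ι) (F : ι → MvPowerSeries (Fin 2) ℚ) :
    ray a b (∑ i ∈ S, F i) = ∑ i ∈ S, ray a b (F i) := by
  ext j; simp [coeff_ray]

/-- If a sum of two exponents and its first summand lie on the line e = 0, so does the second, as e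
is additive. So for a factor supported on that line, reading off the ray is multiplicative. -/
theorem ray_mul {a b : ℕ} (ha : 0 < a) (he : ∀ d, e d = 0 ↔ ∃ j, d = rayExp a b j)
    (hf : ∀ d, e d ≠ 0 → coeff d f = 0) (g : MvPowerSeries (Fin 2) ℚ) :
    ray a b (f * g) = ray a b f * ray a b g := by
  classical
  ext m
  rw [coeff_ray, coeff_mul, PowerSeries.coeff_mul]
  symm
  refine Finset.sum_of_injOn (fun x => (rayExp a b x.1, rayExp a b x.2)) ?_ ?_ ?_ ?_
  · intro x _ y _ h
    rw [Prod.mk.injEq] at h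
    exact Prod.ext (rayExp_injective ha b h.1) (rayExp_injective ha b h.2)
  · intro x hx
    have hx : x.1 + x.2 = m := Finset.HasAntidiagonal.mem_antidiagonal.mp hx
    simp [rayExp_add, hx]
  · intro x hx hx'
    have hx : x.1 + x.2 = rayExp a b m := Finset.HasAntidiagonal.mem_antidiagonal.mp hx
    by_cases h1 : e x.1 = 0
    · exfalso
      apply hx'
      have h2 : e x.2 = 0 := by
        have := congrArg e hx
        rw [map_add, h1, zero_add, (he _).mpr ⟨m, rfl⟩] at this
        exact this
      obtain ⟨i, hi⟩ := (he _).mp h1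
      obtain ⟨j, hj⟩ := (he _).mp h2
      rw [hi, hj, rayExp_add] at hx
      refine ⟨(i, j), ?_, ?_⟩
      · simpa using rayExp_injective ha b hx
      · simp [← hi, ← hj]
    · rw [hf _ h1, zero_mul]
  · intro x _
    rw [coeff_ray, coeff_ray]

theorem ray_X_add_X_pow (a b k m : ℕ) :
    PowerSeries.coeff m (ray a b ((X 0 + X 1) ^ k)) =
      if (a + b) * m = k then (((a + b) * m).choose (a * m) : ℚ) else 0 := by
  rw [coeff_ray, coeff_X_add_X_pow, rayExp_zero, rayExp_one, ← add_mul]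

theorem ray_euler (a b : ℕ) (f : MvPowerSeries (Fin 2) ℚ) :
    ray a b (euler f) =
      ((a + b : ℕ) : PowerSeries ℚ) * (PowerSeries.X * PowerSeries.derivative ℚ (ray a b f)) := by
  ext m
  rw [← map_natCast (PowerSeries.C (R := ℚ)), PowerSeries.coeff_C_mul,
    PowerSeries.coeff_X_mul_derivative, coeff_ray, coeff_ray, coeff_euler, rayExp_zero, rayExp_one]
  push_cast
  ring

/-- The inverse of `1 + h - (x + y)` along a ray. -/
theorem ray_inverse_eq_subst {a b : ℕ} (ha : 0 < a)
    (he : ∀ d, e d = 0 ↔ ∃ j, d = rayExp a b j) {Q K : MvPowerSeries (Fin 2) ℚ}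
    (hQ : ∀ d, e d ≠ 0 → coeff d Q = 0) (hQ0 : coeff 0 Q = 1)
    (hK : (Q - (X 0 + X 1)) * K = 1) :
    (PowerSeries.mk fun j => (((a + b) * j).choose (a * j) : ℚ)).subst
        (PowerSeries.X * (ray a b Q)⁻¹ ^ (a + b) : PowerSeries ℚ) =
      ray a b Q * ray a b K := by
  set P := ray a b Q with hP
  set s := a + b with hs
  have hP0 : PowerSeries.constantCoeff P = 1 := by
    rw [← PowerSeries.coeff_zero_eq_constantCoeff_apply, hP, coeff_ray, ← hQ0]
    congr 1
    exact congrArg _ (exp_ext (by simp) (by simp))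
  have hPP := isUnit_series hP0
  have hpow : ∀ n f, ray a b (Q ^ n * f) = P ^ n * ray a b f := by
    intro n f
    induction n with
    | zero => simp
    | succ n ih => rw [pow_succ', mul_assoc, ray_mul ha he hQ, ih, pow_succ', mul_assoc]
  -- A finite form of 1/(Q - w) = ∑ w^k / Q^(k+1), with w = x + y.
  have hgeom : ∀ N, Q ^ N * K =
      ∑ i ∈ Finset.range N, Q ^ i * (X 0 + X 1) ^ (N - 1 - i) + (X 0 + X 1) ^ N * K := by
    intro N
    have := (Commute.all Q (X 0 + X 1)).geom_sum₂_mul N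
    linear_combination (-K) * this + (∑ i ∈ Finset.range N, Q ^ i * (X 0 + X 1) ^ (N - 1 - i)) * hK
  have hs0 : 0 < s := by omega
  have hy : ∀ j, (PowerSeries.X * P⁻¹ ^ s) ^ j = PowerSeries.X ^ j * P⁻¹ ^ (s * j) := by
    intro j; rw [mul_pow, ← pow_mul]
  ext m
  -- With this N the remainder w^N K has only terms of total degree at least s(m+1). On the ray it
  -- therefore starts at X^(m+1) and does not affect the coefficient of X^m.
  set N := s * (m + 1) with hN
  have hexp : P * ray a b K = ∑ k ∈ Finset.range N, P⁻¹ ^ k * ray a b ((X 0 + X 1) ^ k) +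
      P⁻¹ ^ N * P * ray a b ((X 0 + X 1) ^ N * K) := by
    have h1 := congrArg (ray a b) (hgeom N)
    rw [hpow, ray_add, ray_sum, Finset.sum_congr rfl fun i _ => hpow i _] at h1
    have h2 : ∑ i ∈ Finset.range N, P ^ i * ray a b ((X 0 + X 1) ^ (N - 1 - i)) =
        ∑ k ∈ Finset.range N, P ^ (N - 1 - k) * ray a b ((X 0 + X 1) ^ k) := by
      rw [← Finset.sum_range_reflect]
      refine Finset.sum_congr rfl fun k hk => ?_
      have := Finset.mem_range.mp hk
      rw [show N - 1 - (N - 1 - k) = k by omega]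
    have h3 : ∑ k ∈ Finset.range N, P⁻¹ ^ k * ray a b ((X 0 + X 1) ^ k) =
        P⁻¹ ^ N * P * ∑ k ∈ Finset.range N, P ^ (N - 1 - k) * ray a b ((X 0 + X 1) ^ k) := by
      rw [Finset.mul_sum]
      refine Finset.sum_congr rfl fun k hk => ?_
      have := Finset.mem_range.mp hk
      obtain ⟨l, hl⟩ : ∃ l, N = k + (l + 1) := ⟨N - 1 - k, by omega⟩
      have e1 : P ^ (l + 1) * P⁻¹ ^ (l + 1) = 1 := by rw [← mul_pow, hPP, one_pow]
      rw [show N - 1 - k = l by omega, hl, pow_add]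
      rw [pow_succ] at e1
      linear_combination (-P⁻¹ ^ k * ray a b ((X 0 + X 1) ^ k)) * e1
    have e2 : P ^ N * P⁻¹ ^ N = 1 := by rw [← mul_pow, hPP, one_pow]
    rw [h3, ← h2]
    linear_combination (P⁻¹ ^ N * P) * h1 - P * ray a b K * e2
  have hrest : PowerSeries.coeff m (P⁻¹ ^ N * P * ray a b ((X 0 + X 1) ^ N * K)) = 0 := by
    have hdvd : PowerSeries.X ^ (m + 1) ∣ ray a b ((X 0 + X 1) ^ N * K) := by
      rw [PowerSeries.X_pow_dvd_iff]
      intro j hj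
      rw [coeff_ray, coeff_X_add_X_pow_mul]
      rw [rayExp_zero, rayExp_one, ← add_mul]
      exact Nat.mul_lt_mul_of_pos_left hj hs0
    exact PowerSeries.X_pow_dvd_iff.mp (hdvd.mul_left _) m (Nat.lt_succ_self m)
  have hterm : ∀ j, ray a b ((X 0 + X 1) ^ (s * j)) =
      PowerSeries.C ((s * j).choose (a * j) : ℚ) * PowerSeries.X ^ j := by
    intro j
    ext n
    rw [ray_X_add_X_pow, PowerSeries.coeff_C_mul, PowerSeries.coeff_X_pow, ← hs]
    by_cases h : n = j
    · subst h; simp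
    · rw [if_neg h, if_neg (fun h' => h (Nat.eq_of_mul_eq_mul_left hs0 h')), mul_zero]
  have hsub : PowerSeries.HasSubst (PowerSeries.X * P⁻¹ ^ s : PowerSeries ℚ) := hasSubst_X_mul _
  rw [hexp, map_add, hrest, add_zero, map_sum, PowerSeries.coeff_subst' hsub,
    finsum_eq_sum_of_support_subset (s := Finset.range (m + 1))]
  · refine Finset.sum_of_injOn (fun j => s * j) ?_ ?_ ?_ ?_
    · intro i _ j _ h
      exact Nat.eq_of_mul_eq_mul_left hs0 h
    · intro j hj
      simp only [Finset.coe_range, Set.mem_Iio] at hj ⊢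
      exact Nat.mul_lt_mul_of_pos_left hj hs0
    · intro k hk hk'
      have : ray a b ((X 0 + X 1) ^ k) = 0 := by
        ext n
        rw [ray_X_add_X_pow, ← hs, if_neg, map_zero]
        rintro rfl
        apply hk'
        refine ⟨n, ?_, rfl⟩
        simp only [Finset.coe_range, Set.mem_Iio]
        exact Nat.lt_of_mul_lt_mul_left (Finset.mem_range.mp hk)
      rw [this, mul_zero, map_zero]
    · intro j _
      rw [hterm, hy, PowerSeries.coeff_mk, mul_comm (PowerSeries.X ^ j), smul_eq_mul,
        ← PowerSeries.coeff_C_mul]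
      congr 1
      ring
  · intro j hj
    rw [Function.mem_support] at hj
    by_contra h
    apply hj
    simp only [Finset.coe_range, Set.mem_Iio] at h
    rw [hy, PowerSeries.coeff_X_pow_mul', if_neg (by omega), smul_zero]

/-- The number of planted plane trees with given numbers of black and white vertices, divided by
the factorials of these numbers, where `e` is the excess. -/
noncomputable def plantedCoeff (e : (Fin 2 →₀ ℕ) →+ ℤ) (d : Fin 2 →₀ ℕ) : ℚ :=
  (if d 0 + d 1 = 1 then 1 else 0) +
    ∑ x ∈ (Finset.HasAntidiagonal.antidiagonal d).attach,
      if _h : 0 < e x.1.1 ∧ e x.1.2 < 0 then plantedCoeff e x.1.1 * plantedCoeff e x.1.2 else 0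
termination_by d 0 + d 1
decreasing_by
  · have h1 := size_add (Finset.HasAntidiagonal.mem_antidiagonal.mp x.2)
    have h2 : x.1.2 ≠ 0 := by intro h0; rw [h0, map_zero] at _h; exact lt_irrefl _ _h.2
    have := size_pos h2
    omega
  · have h1 := size_add (Finset.HasAntidiagonal.mem_antidiagonal.mp x.2)
    have h2 : x.1.1 ≠ 0 := by intro h0; rw [h0, map_zero] at _h; exact lt_irrefl _ _h.1
    have := size_pos h2
    omega

theorem plantedCoeff_eq (e : (Fin 2 →₀ ℕ) →+ ℤ) (d : Fin 2 →₀ ℕ) :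
    plantedCoeff e d = (if d 0 + d 1 = 1 then 1 else 0) +
      ∑ x ∈ Finset.HasAntidiagonal.antidiagonal d,
        if 0 < e x.1 ∧ e x.2 < 0 then plantedCoeff e x.1 * plantedCoeff e x.2 else 0 := by
  rw [plantedCoeff, ← Finset.sum_attach (Finset.HasAntidiagonal.antidiagonal d)]
  simp only [dite_eq_ite]

/-- The part of the series of planted trees with excess satisfying `c`. -/
noncomputable def plantedPart (e : (Fin 2 →₀ ℕ) →+ ℤ) (c : ℤ → Prop) [DecidablePred c] :
    MvPowerSeries (Fin 2) ℚ :=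
  fun d => if c (e d) then plantedCoeff e d else 0

theorem coeff_plantedPart (e : (Fin 2 →₀ ℕ) →+ ℤ) (c : ℤ → Prop) [DecidablePred c]
    (d : Fin 2 →₀ ℕ) :
    coeff d (plantedPart e c) = if c (e d) then plantedCoeff e d else 0 := rfl

/-- The Wiener-Hopf factorization of the series of planted trees. -/
theorem plantedPart_factorization (e : (Fin 2 →₀ ℕ) →+ ℤ) :
    (1 - plantedPart e (0 < ·)) * (1 - plantedPart e (· < 0)) =
      1 + plantedPart e (· = 0) - (X 0 + X 1) := by
  classical
  -- The product on the left expands to 1 - U - D + UD, so the claim is the recursion U + D + H = (x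
  -- + y) + UD.
  suffices h : plantedPart e (0 < ·) + plantedPart e (· < 0) + plantedPart e (· = 0) =
      (X 0 + X 1) + plantedPart e (0 < ·) * plantedPart e (· < 0) by
    linear_combination -h
  ext d
  have h1 : coeff d (plantedPart e (0 < ·) + plantedPart e (· < 0) + plantedPart e (· = 0)) =
      plantedCoeff e d := by
    rw [map_add, map_add, coeff_plantedPart, coeff_plantedPart, coeff_plantedPart]
    rcases lt_trichotomy (e d) 0 with h | h | h
    · simp [h, h.not_gt, h.ne]
    · simp [h]
    · simp [h, h.not_gt, h.ne']
  have h2 : coeff d (X 0 + X 1 : MvPowerSeries (Fin 2) ℚ) =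
      if d 0 + d 1 = 1 then 1 else 0 := by
    have := coeff_X_add_X_pow 1 d
    rw [pow_one] at this
    rw [this]
    split_ifs with h
    · have : d 0 = 0 ∨ d 0 = 1 := by omega
      rw [h]
      rcases this with h0 | h0 <;> rw [h0] <;> simp
    · rfl
  rw [h1, map_add, h2, plantedCoeff_eq, coeff_mul]
  congr 1
  refine Finset.sum_congr rfl fun x _ => ?_
  rw [coeff_plantedPart, coeff_plantedPart]
  by_cases h3 : 0 < e x.1 <;> by_cases h4 : e x.2 < 0 <;> simp [h3, h4]

/-- The equation for the series of balanced trees rooted at an edge. -/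
theorem ray_planted_equation {e : (Fin 2 →₀ ℕ) →+ ℤ} {a b : ℕ} (ha : 0 < a)
    (he : ∀ d, e d = 0 ↔ ∃ j, d = rayExp a b j) :
    ∃ P : PowerSeries ℚ, PowerSeries.constantCoeff P = 1 ∧
      (∀ j, 0 < j → PowerSeries.coeff j P = plantedCoeff e (rayExp a b j)) ∧
      (PowerSeries.mk fun j => (((a + b) * j).choose (a * j) : ℚ)).subst
        (PowerSeries.X * P⁻¹ ^ (a + b) : PowerSeries ℚ) *
        (1 - ((a + b : ℕ) : PowerSeries ℚ) *
          (PowerSeries.X * PowerSeries.derivative ℚ P * P⁻¹)) = 1 := by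
  classical
  set U := plantedPart e (0 < ·) with hU
  set D := plantedPart e (· < 0) with hD
  set H := plantedPart e (· = 0) with hH
  set w : MvPowerSeries (Fin 2) ℚ := X 0 + X 1 with hw
  have hfac : (1 - U) * (1 - D) = 1 + H - w := plantedPart_factorization e
  have hUpos : PosSupp e U := by
    intro d hd; rw [hU, coeff_plantedPart, if_neg hd.not_gt]
  have hDpos : PosSupp (-e) D := by
    intro d hd
    rw [hD, coeff_plantedPart, if_neg]
    have : (-e) d = -(e d) := rfl
    omega
  have hU0 : coeff 0 U = 0 := by rw [hU, coeff_plantedPart, map_zero]; simp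
  have hD0 : coeff 0 D = 0 := by rw [hD, coeff_plantedPart, map_zero]; simp
  have hH0 : coeff 0 H = 0 := by
    rw [hH, coeff_plantedPart, map_zero, plantedCoeff_eq]
    simp
  have inv : ∀ f : MvPowerSeries (Fin 2) ℚ, coeff 0 f = 0 → (1 - f)⁻¹ * (1 - f) = 1 := by
    intro f hf
    apply MvPowerSeries.inv_mul_cancel
    rw [map_sub, ← coeff_zero_eq_constantCoeff_apply, ← coeff_zero_eq_constantCoeff_apply, hf]
    simp
  have hFU := inv U hU0
  have hFD := inv D hD0
  set FU := (1 - U)⁻¹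
  set FD := (1 - D)⁻¹
  have hFUn : NonnegSupp e FU := hUpos.nonneg.of_mul_one_sub hU0 hFU
  have hFDn : NonnegSupp (-e) FD := hDpos.nonneg.of_mul_one_sub hD0 hFD
  have hK : (1 + H - w) * (FU * FD) = 1 := by
    rw [← hfac]
    linear_combination FD * (1 - D) * hFU + hFD
  have hQ : ∀ d, e d ≠ 0 → coeff d (1 + H) = 0 := by
    intro d hd
    have hd0 : d ≠ 0 := by rintro rfl; simp at hd
    rw [map_add, coeff_one, if_neg hd0, hH, coeff_plantedPart, if_neg hd, zero_add]
  have hE : ∀ d, e d ≠ 0 → coeff d (euler (1 + H)) = 0 := by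
    intro d hd
    rw [coeff_euler, hQ d hd, mul_zero]
  have hQ0 : coeff 0 (1 + H) = 1 := by rw [map_add, hH0, coeff_one, if_pos rfl, add_zero]
  have hsub := ray_inverse_eq_subst ha he hQ hQ0 hK
  have hew : euler w = w := by rw [hw, euler_add, euler_X, euler_X]
  -- The Euler derivative of the factorization divided by the factorization: the sum of the
  -- logarithmic derivatives of 1 - U and 1 - D.
  have hlog : (euler (1 + H) - w) * (FU * FD) = -(euler U * FU) - euler D * FD := by
    have h1 := congrArg euler hfac
    rw [euler_mul, euler_sub, euler_sub, euler_sub, euler_one, hew] at h1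
    linear_combination (-FU * FD) * h1 - (euler U * FU) * hFD - (euler D * FD) * hFU
  -- The two terms on the right of `hlog` are supported on e > 0 and on e < 0, so neither meets the
  -- ray. This removes U and D from the equation.
  have hzero : ray a b (euler (1 + H) * (FU * FD)) = ray a b (w * (FU * FD)) := by
    ext j
    have h0 : e (rayExp a b j) = 0 := (he _).mpr ⟨j, rfl⟩
    have h1 := congrArg (coeff (rayExp a b j)) hlog
    rw [map_sub, map_neg, hUpos.euler.mul_nonneg hFUn _ h0.le,
      hDpos.euler.mul_nonneg hFDn _ (by simp [h0]), sub_mul, map_sub] at h1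
    rw [coeff_ray, coeff_ray]
    linarith
  refine ⟨ray a b (1 + H), ?_, ?_, ?_⟩
  · rw [← PowerSeries.coeff_zero_eq_constantCoeff_apply, coeff_ray, ← hQ0]
    congr 1
    exact congrArg _ (exp_ext (by simp) (by simp))
  · intro j hj
    have h0 : e (rayExp a b j) = 0 := (he _).mpr ⟨j, rfl⟩
    have hne : rayExp a b j ≠ 0 := by
      intro h
      have := DFunLike.congr_fun h 0
      rw [rayExp_zero] at this
      exact (Nat.mul_pos ha hj).ne' this
    rw [coeff_ray, map_add, coeff_one, if_neg hne, zero_add, hH, coeff_plantedPart, if_pos h0]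
  · rw [hsub]
    have hP0 : PowerSeries.constantCoeff (ray a b (1 + H)) = 1 := by
      rw [← PowerSeries.coeff_zero_eq_constantCoeff_apply, coeff_ray, ← hQ0]
      congr 1
      exact congrArg _ (exp_ext (by simp) (by simp))
    have hPP := isUnit_series hP0
    rw [ray_mul ha he hE, ray_euler] at hzero
    have h1 : (1 + H) * (FU * FD) = 1 + w * (FU * FD) := by linear_combination hK
    have h2 := congrArg (ray a b) h1
    rw [ray_mul ha he hQ, ray_add a b 1 (w * _), ← hzero] at h2
    have h3 : ray a b 1 = 1 := by
      ext j
      rw [coeff_ray, coeff_one, PowerSeries.coeff_one]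
      refine if_congr ?_ rfl rfl
      constructor
      · intro h
        have := DFunLike.congr_fun h 0
        rw [rayExp_zero] at this
        simpa [ha.ne'] using this
      · rintro rfl
        exact exp_ext (by simp) (by simp)
    rw [h3] at h2
    linear_combination h2 - ((a + b : ℕ) : PowerSeries ℚ) * PowerSeries.X *
      PowerSeries.derivative ℚ (ray a b (1 + H)) * ray a b (FU * FD) * hPP

end Bivariate

/-! ### The coefficient of the balanced trees in closed form. -/

/-- The excess of the black weight over the white weight, for black vertices of weight `q` and
white vertices of weight `p`. -/
noncomputable def excessHom (p q : ℕ) : (Fin 2 →₀ ℕ) →+ ℤ where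
  toFun d := (d 0 : ℤ) * q - (d 1 : ℤ) * p
  map_zero' := by simp
  map_add' d d' := by simp only [Finsupp.add_apply]; push_cast; ring

theorem excessHom_apply (p q : ℕ) (d : Fin 2 →₀ ℕ) :
    excessHom p q d = (d 0 : ℤ) * q - (d 1 : ℤ) * p := rfl

theorem excessHom_eq_zero_iff {g a b : ℕ} (hg : 0 < g) (ha : 0 < a) (hab : Nat.Coprime a b)
    (d : Fin 2 →₀ ℕ) : excessHom (a * g) (b * g) d = 0 ↔ ∃ j, d = rayExp a b j := by
  rw [excessHom_apply]
  constructor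
  · intro h
    have h1 : d 0 * b = d 1 * a := by
      have : (d 0 * b) * g = (d 1 * a) * g := by
        zify
        push_cast at h
        linarith
      exact Nat.eq_of_mul_eq_mul_right hg this
    have h2 : a ∣ d 0 := hab.dvd_of_dvd_mul_right ⟨d 1, by rw [h1, mul_comm]⟩
    obtain ⟨j, hj⟩ := h2
    refine ⟨j, exp_ext (by simpa using hj) ?_⟩
    rw [rayExp_one]
    rw [hj] at h1
    apply Nat.eq_of_mul_eq_mul_left ha
    linarith
  · rintro ⟨j, rfl⟩
    simp only [rayExp_zero, rayExp_one]
    push_cast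
    ring

-- The exponent (p,q) is g₀ times the primitive vector (a,b), so this is the coefficient of X^g₀ in
-- P, to which the Lagrange formula applies with sm = p+q.
open PowerSeries in
theorem plantedCoeff_eq_sum (p q : ℕ) (hp : 0 < p) (hq : 0 < q) :
    plantedCoeff (excessHom p q) (Finsupp.single 0 p + Finsupp.single 1 q) =
      ((p : ℚ) + q - 1) * ∑ n ∈ typesOne (Nat.gcd p q), COne p q n := by
  obtain ⟨a, b, hab, hpa, hqb⟩ : ∃ a b, Nat.Coprime a b ∧ p = a * Nat.gcd p q ∧
      q = b * Nat.gcd p q := by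
    obtain ⟨a, b, h, h1, h2⟩ := Nat.exists_coprime p q
    exact ⟨a, b, h, h1, h2⟩
  set g := Nat.gcd p q with hgdef
  have hg : 0 < g := Nat.gcd_pos_of_pos_left _ hp
  have ha : 0 < a := Nat.pos_of_mul_pos_right (hpa ▸ hp)
  have hb : 0 < b := Nat.pos_of_mul_pos_right (hqb ▸ hq)
  have he : ∀ d, excessHom p q d = 0 ↔ ∃ j, d = rayExp a b j := by
    intro d
    have := excessHom_eq_zero_iff hg ha hab d
    rwa [← hpa, ← hqb] at this
  obtain ⟨P, hP0, hPc, hP⟩ := ray_planted_equation ha he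
  -- Multiplying the j-th coefficient by (a+b)j completes the factorial to a binomial coefficient,
  -- which gives `hB`. The value at 0 is set by hand: with `0 - 1 = 0` the quotient would be 1
  -- there, and F must have no constant term.
  set F : PowerSeries ℚ := PowerSeries.mk fun j => if j = 0 then 0 else
    ((((a + b) * j - 1).factorial : ℚ) / ((a * j).factorial * (b * j).factorial)) with hF
  have hB : (PowerSeries.mk fun j => (((a + b) * j).choose (a * j) : ℚ)) =
      1 + ((a + b : ℕ) : PowerSeries ℚ) * (X * d⁄dX ℚ F) := by
    ext j
    rw [coeff_mk, map_add, ← map_natCast (PowerSeries.C (R := ℚ)), coeff_C_mul,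
      coeff_X_mul_derivative, coeff_one, hF, coeff_mk]
    by_cases hj : j = 0
    · simp [hj]
    · rw [if_neg hj, if_neg hj]
      have hpos : 0 < (a + b) * j := Nat.mul_pos (by omega) (by omega)
      rw [add_mul, Nat.cast_add_choose, ← add_mul, ← Nat.mul_factorial_pred hpos.ne']
      push_cast
      ring
  have main := coeff_of_subst_kernel hP0 (s := a + b) (by omega) (F := F) (by simp [hF]) hB hP hg
  rw [hPc g hg] at main
  have hd : rayExp a b g = Finsupp.single 0 p + Finsupp.single 1 q := by
    rw [rayExp, ← hpa, ← hqb]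
  have hN : ((a + b : ℕ) : ℚ) * g = (p : ℚ) + q := by
    rw [hpa, hqb]; push_cast; ring
  rw [hd, hN] at main
  have hN1 : (p : ℚ) + q - 1 ≠ 0 := by
    have h1 : (1 : ℚ) ≤ p := by exact_mod_cast hp
    have h2 : (1 : ℚ) ≤ q := by exact_mod_cast hq
    intro h; linarith
  set N : ℚ := (p : ℚ) + q - 1 with hNdef
  have hterm : ∀ n : Fin g → ℕ, ∏ i : Fin g, (1 / ((n i).factorial : ℚ)) *
      (-N * coeff ((i : ℕ) + 1) F) ^ n i = -N ^ 2 * COne p q n := by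
    intro n
    have hc : ∀ i : Fin g, coeff ((i : ℕ) + 1) F =
        (((((i : ℕ) + 1) * (p + q) / g - 1).factorial : ℚ) /
          (((((i : ℕ) + 1) * p / g).factorial : ℚ) *
            ((((i : ℕ) + 1) * q / g).factorial : ℚ))) := by
      intro i
      have e1 : ((i : ℕ) + 1) * p / g = a * (i + 1) := by
        conv_lhs => rw [hpa]
        rw [← mul_assoc, Nat.mul_div_cancel _ hg, mul_comm]
      have e2 : ((i : ℕ) + 1) * q / g = b * (i + 1) := by
        conv_lhs => rw [hqb]
        rw [← mul_assoc, Nat.mul_div_cancel _ hg, mul_comm]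
      have e3 : ((i : ℕ) + 1) * (p + q) / g = (a + b) * (i + 1) := by
        conv_lhs => rw [hpa, hqb]
        rw [← add_mul, ← mul_assoc, Nat.mul_div_cancel _ hg, mul_comm]
      rw [e1, e2, e3, hF, coeff_mk, if_neg (Nat.succ_ne_zero _)]
    simp only [hc, mul_pow]
    have hCO : COne p q n = (-1 : ℚ) ^ ((∑ i, n i : ℕ) - 1 : ℤ) * N ^ ((∑ i, n i : ℕ) - 2 : ℤ) *
        ∏ i : Fin g, (1 / ((n i).factorial : ℚ)) *
          (((((i : ℕ) + 1) * (p + q) / g - 1).factorial : ℚ) /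
            (((((i : ℕ) + 1) * p / g).factorial : ℚ) *
              ((((i : ℕ) + 1) * q / g).factorial : ℚ))) ^ n i := rfl
    rw [hCO]
    have hprod : ∏ i : Fin g, (-N) ^ n i = (-N) ^ (∑ i, n i) := Finset.prod_pow_eq_pow_sum _ _ _
    -- The factor -N² absorbs the shifts in the integer exponents n-1 and n-2 of `COne`; the second
    -- is negative when n = 1, so N ≠ 0 is needed.
    have hpow : (-N) ^ (∑ i, n i) =
        -N ^ 2 * ((-1 : ℚ) ^ ((∑ i, n i : ℕ) - 1 : ℤ) * N ^ ((∑ i, n i : ℕ) - 2 : ℤ)) := by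
      rw [zpow_sub₀ (by norm_num), zpow_sub₀ hN1, zpow_natCast, zpow_natCast, neg_pow]
      simp only [zpow_one]
      rw [show (2 : ℤ) = ((2 : ℕ) : ℤ) from rfl, zpow_natCast]
      field_simp
    simp only [Finset.prod_mul_distrib]
    rw [hprod, hpow]
    ring
  rw [Finset.sum_congr rfl fun n _ => hterm n, ← Finset.mul_sum] at main
  apply mul_left_cancel₀ hN1
  rw [hNdef] at main ⊢
  linear_combination -main

/-! ### Weighted trees as symmetric matrices: cutting and joining at the root. -/

section WeightedTrees

set_option linter.unusedSectionVars false

variable {V : Type} [Fintype V] [DecidableEq V]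

/-- The number of vertices joined to `v` by an edge of positive weight. -/
def wdeg (μ : V → V → ℕ) (v : V) : ℕ := ∑ u, if 0 < μ v u then 1 else 0

/-- The number of ordered pairs of vertices of `S` joined by an edge of positive weight. -/
def adjPairs (μ : V → V → ℕ) (S : Finset V) : ℕ := ∑ u ∈ S, ∑ v ∈ S, if 0 < μ u v then 1 else 0

/-- Every proper nonempty subset of `A` is joined to its complement in `A`. -/
def CutConnected (μ : V → V → ℕ) (A : Finset V) : Prop :=
  ∀ S ⊆ A, S.Nonempty → S ≠ A → ∃ u ∈ S, ∃ v ∈ A \ S, 0 < μ u v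

/-- `1` at black and `-1` at white vertices. -/
def colorSign (σ : V → Bool) (v : V) : ℤ := if σ v then 1 else -1

/-- The excess of the black over the white weight. -/
def excess (σ : V → Bool) (a : V → ℕ) (A : Finset V) : ℤ := ∑ v ∈ A, colorSign σ v * a v

/-- Weighted bi-colored trees on the vertex set `A` with prescribed weights of the vertices other
than the root `r`. -/
structure RootedWTree (σ : V → Bool) (a : V → ℕ) (A : Finset V) (r : V) (μ : V → V → ℕ) :
    Prop where
  symm : ∀ u v, μ u v = μ v u
  supp : ∀ u v, 0 < μ u v → u ∈ A
  bip : ∀ u v, 0 < μ u v → σ u ≠ σ v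
  conn : CutConnected μ A
  count : adjPairs μ A + 2 = 2 * A.card
  root_mem : r ∈ A
  sum_eq : ∀ v ∈ A, v ≠ r → ∑ u, μ v u = a v

/-- Restriction of the edges to a set of vertices. -/
def restrictEdges (μ : V → V → ℕ) (S : Finset V) : V → V → ℕ :=
  fun u v => if u ∈ S ∧ v ∈ S then μ u v else 0

/-- The union of two weighted trees and an edge of weight `m` between `r` and `c`. -/
def joinEdges (μ₁ μ₂ : V → V → ℕ) (r c : V) (m : ℕ) : V → V → ℕ :=
  fun u v => if (u = r ∧ v = c) ∨ (u = c ∧ v = r) then m else μ₁ u v + μ₂ u v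

variable {σ : V → Bool} {a : V → ℕ} {A D : Finset V} {r c : V} {μ μ₁ μ₂ : V → V → ℕ}

theorem colorSign_mul_self (σ : V → Bool) (v : V) : colorSign σ v * colorSign σ v = 1 := by
  unfold colorSign; split_ifs <;> rfl

theorem colorSign_eq_neg {u v : V} (h : σ u ≠ σ v) : colorSign σ u = -colorSign σ v := by
  unfold colorSign
  cases hu : σ u <;> cases hv : σ v <;> simp_all

/-- The only edge between the two parts is the one from r to c; it is counted in both orders, whence
the summand 2. -/
theorem adjPairs_union {C D : Finset V} (hCD : Disjoint C D) (hr : r ∈ C) (hc : c ∈ D)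
    (hsymm : ∀ u v, μ u v = μ v u) (hrc : 0 < μ r c)
    (hcut : ∀ u ∈ C, ∀ v ∈ D, 0 < μ u v → u = r ∧ v = c) :
    adjPairs μ (C ∪ D) = adjPairs μ C + adjPairs μ D + 2 := by
  have h1 : ∑ u ∈ C, ∑ v ∈ D, (if 0 < μ u v then 1 else 0) = 1 := by
    rw [Finset.sum_eq_single_of_mem r hr, Finset.sum_eq_single_of_mem c hc, if_pos hrc]
    · intro v hv hne
      exact if_neg fun h => hne (hcut r hr v hv h).2
    · intro u hu hne
      exact Finset.sum_eq_zero fun v hv => if_neg fun h => hne (hcut u hu v hv h).1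
  have h2 : ∑ u ∈ D, ∑ v ∈ C, (if 0 < μ u v then 1 else 0) = 1 := by
    refine Eq.trans ?_ h1
    rw [Finset.sum_comm]
    exact Finset.sum_congr rfl fun u _ => Finset.sum_congr rfl fun v _ => by rw [hsymm v u]
  unfold adjPairs
  rw [Finset.sum_union hCD]
  simp only [Finset.sum_union hCD, Finset.sum_add_distrib]
  omega

theorem adjPairs_congr {ν : V → V → ℕ} {S : Finset V}
    (h : ∀ u ∈ S, ∀ v ∈ S, μ u v = ν u v) : adjPairs μ S = adjPairs ν S :=
  Finset.sum_congr rfl fun u hu => Finset.sum_congr rfl fun v hv => by rw [h u hu v hv]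

theorem CutConnected.congr {ν : V → V → ℕ} {S : Finset V} (hμ : CutConnected μ S)
    (h : ∀ u ∈ S, ∀ v ∈ S, μ u v = ν u v) : CutConnected ν S := by
  intro T hT hne hTS
  obtain ⟨u, hu, v, hv, huv⟩ := hμ T hT hne hTS
  exact ⟨u, hu, v, hv, by rwa [← h u (hT hu) v (Finset.sdiff_subset hv)]⟩

/-- Grow a set from r one vertex at a time: connectedness supplies a vertex with an edge to the set,
which adds at least two ordered pairs. -/
theorem CutConnected.le_adjPairs (hsymm : ∀ u v, μ u v = μ v u) (h : CutConnected μ A)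
    (hr : r ∈ A) : 2 * A.card ≤ adjPairs μ A + 2 := by
  have key : ∀ k, k + 1 ≤ A.card → ∃ S ⊆ A, r ∈ S ∧ S.card = k + 1 ∧
      2 * S.card ≤ adjPairs μ S + 2 := by
    intro k
    induction k with
    | zero =>
      intro _
      exact ⟨{r}, by simpa using hr, by simp, by simp, by simp⟩
    | succ k ih =>
      intro hk
      obtain ⟨S, hSA, hrS, hcard, hS⟩ := ih (by omega)
      obtain ⟨u, hu, v, hv, huv⟩ := h S hSA ⟨r, hrS⟩ (by rintro rfl; omega)
      obtain ⟨hvA, hvS⟩ := Finset.mem_sdiff.mp hv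
      refine ⟨insert v S, ?_, ?_, ?_, ?_⟩
      · exact Finset.insert_subset hvA hSA
      · exact Finset.mem_insert_of_mem hrS
      · rw [Finset.card_insert_of_notMem hvS, hcard]
      · rw [Finset.card_insert_of_notMem hvS]
        have e1 : 1 ≤ ∑ w ∈ S, if 0 < μ w v then 1 else 0 := by
          have := Finset.single_le_sum (f := fun w => if 0 < μ w v then 1 else 0)
            (fun _ _ => Nat.zero_le _) hu
          simpa [huv] using this
        have e2 : 1 ≤ ∑ w ∈ S, if 0 < μ v w then 1 else 0 := by
          simpa only [hsymm v] using e1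
        have e3 : adjPairs μ (insert v S) = (if 0 < μ v v then 1 else 0) +
            (∑ w ∈ S, if 0 < μ v w then 1 else 0) +
            ((∑ w ∈ S, if 0 < μ w v then 1 else 0) + adjPairs μ S) := by
          unfold adjPairs
          rw [Finset.sum_insert hvS]
          simp only [Finset.sum_insert hvS, Finset.sum_add_distrib]
        omega
  have hpos : 0 < A.card := Finset.card_pos.mpr ⟨r, hr⟩
  obtain ⟨S, hSA, _, hcard, hS⟩ := key (A.card - 1) (by omega)
  have : S = A := Finset.eq_of_subset_of_card_le hSA (by omega)
  rwa [this] at hS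

/-- A part attached by a single vertex is connected. -/
theorem CutConnected.of_attached (hsymm : ∀ u v, μ u v = μ v u) (h : CutConnected μ A)
    (hD : D ⊆ A) (hc : c ∈ D) (hcut : ∀ u ∈ A \ D, ∀ v ∈ D, 0 < μ u v → v = c) : CutConnected μ D := by
  -- An edge leaving S in A cannot leave D, since edges out of D start at c and c is not in S. If c
  -- lies in S, this is applied to the complement of S in D.
  have aux : ∀ S ⊆ D, S.Nonempty → c ∉ S → ∃ u ∈ S, ∃ v ∈ D \ S, 0 < μ u v := by
    intro S hS hne hcS
    have hSA : S ≠ A := by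
      rintro rfl
      exact hcS (hD hc)
    obtain ⟨u, hu, v, hv, huv⟩ := h S (hS.trans hD) hne hSA
    obtain ⟨hvA, hvS⟩ := Finset.mem_sdiff.mp hv
    by_cases hvD : v ∈ D
    · exact ⟨u, hu, v, Finset.mem_sdiff.mpr ⟨hvD, hvS⟩, huv⟩
    · exact absurd (hcut v (Finset.mem_sdiff.mpr ⟨hvA, hvD⟩) u (hS hu) (by rwa [hsymm]))
        (by rintro rfl; exact hcS hu)
  intro S hS hne hSD
  by_cases hcS : c ∈ S
  · obtain ⟨u, hu, v, hv, huv⟩ := aux (D \ S) Finset.sdiff_subset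
      (Finset.sdiff_nonempty.mpr fun h => hSD (Finset.Subset.antisymm hS h))
      (fun h => (Finset.mem_sdiff.mp h).2 hcS)
    rw [Finset.sdiff_sdiff_eq_self hS] at hv
    exact ⟨v, hv, u, hu, by rwa [hsymm]⟩
  · exact aux S hS hne hcS

theorem RootedWTree.eq_zero_left (h : RootedWTree σ a A r μ) {u : V} (hu : u ∉ A) (v : V) :
    μ u v = 0 := by
  by_contra h0
  exact hu (h.supp u v (Nat.pos_of_ne_zero h0))

theorem RootedWTree.eq_zero_right (h : RootedWTree σ a A r μ) {v : V} (hv : v ∉ A) (u : V) :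
    μ u v = 0 := by
  rw [h.symm]; exact h.eq_zero_left hv u

/-- Every edge is counted from its two ends with opposite signs. -/
theorem sum_colorSign_mul_eq_zero (hsymm : ∀ u v, μ u v = μ v u)
    (hbip : ∀ u v, 0 < μ u v → σ u ≠ σ v) (S : Finset V) :
    ∑ v ∈ S, ∑ u ∈ S, colorSign σ v * (μ v u : ℤ) = 0 := by
  have h : ∑ v ∈ S, ∑ u ∈ S, colorSign σ v * (μ v u : ℤ) =
      -∑ v ∈ S, ∑ u ∈ S, colorSign σ v * (μ v u : ℤ) := by
    conv_lhs => rw [Finset.sum_comm]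
    rw [← Finset.sum_neg_distrib]
    refine Finset.sum_congr rfl fun u _ => ?_
    rw [← Finset.sum_neg_distrib]
    refine Finset.sum_congr rfl fun v _ => ?_
    rcases Nat.eq_zero_or_pos (μ v u) with h0 | h0
    · rw [hsymm u v, h0]; simp
    · rw [colorSign_eq_neg (hbip v u h0), hsymm u v]; ring
  linarith

/-- The signed edge weights cancel in pairs, and every vertex but the root uses up its prescribed
weight. What remains is the weight missing at the root. -/
theorem RootedWTree.excess_eq (h : RootedWTree σ a D c μ) :
    excess σ a D = colorSign σ c * (a c - ((∑ u, μ c u : ℕ) : ℤ)) := by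
  have h1 := sum_colorSign_mul_eq_zero h.symm h.bip D
  have h2 : ∀ v, ∑ u ∈ D, colorSign σ v * (μ v u : ℤ) =
      colorSign σ v * ((∑ u, μ v u : ℕ) : ℤ) := by
    intro v
    rw [← Finset.mul_sum, Nat.cast_sum]
    congr 1
    refine Finset.sum_subset (Finset.subset_univ D) fun u _ hu => ?_
    rw [h.eq_zero_right hu, Nat.cast_zero]
  simp only [h2] at h1
  have h3 : excess σ a D - ∑ v ∈ D, colorSign σ v * ((∑ u, μ v u : ℕ) : ℤ) =
      colorSign σ c * (a c - ((∑ u, μ c u : ℕ) : ℤ)) := by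
    rw [excess, ← Finset.sum_sub_distrib, Finset.sum_eq_single_of_mem c h.root_mem]
    · ring
    · intro v hv hne
      rw [h.sum_eq v hv hne, sub_self]
  rw [h1, sub_zero] at h3
  exact h3

/-- Edges leaving D start at c, so the weights at the other vertices of D are unaffected by the
restriction; c becomes the root, whose weight is not prescribed. -/
theorem RootedWTree.restrict (h : RootedWTree σ a A r μ) (hD : D ⊆ A) (hc : c ∈ D)
    (hcut : ∀ u ∈ A \ D, ∀ v ∈ D, 0 < μ u v → v = c) (hr : r ∈ D → r = c)
    (hcount : adjPairs μ D + 2 = 2 * D.card) :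
    RootedWTree σ a D c (restrictEdges μ D) := by
  have hagree : ∀ u ∈ D, ∀ v ∈ D, μ u v = restrictEdges μ D u v := by
    intro u hu v hv
    rw [restrictEdges, if_pos ⟨hu, hv⟩]
  refine ⟨?_, ?_, ?_, ?_, ?_, hc, ?_⟩
  · intro u v
    simp only [restrictEdges, and_comm, h.symm u v]
  · intro u v huv
    by_contra hu
    rw [restrictEdges, if_neg (fun h => hu h.1)] at huv
    exact lt_irrefl _ huv
  · intro u v huv
    apply h.bip
    rw [restrictEdges] at huv
    split_ifs at huv with h1
    · exact huv
    · exact absurd huv (lt_irrefl _)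
  · exact (h.conn.of_attached h.symm hD hc hcut).congr hagree
  · rw [← adjPairs_congr hagree, hcount]
  · intro v hv hne
    rw [← h.sum_eq v (hD hv) (by rintro rfl; exact hne (hr hv))]
    refine Finset.sum_congr rfl fun u _ => ?_
    by_cases hu : u ∈ D
    · exact (hagree v hv u hu).symm
    · rw [restrictEdges, if_neg (fun h => hu h.2)]
      by_contra h0
      have hpos : 0 < μ u v := by rw [h.symm]; omega
      exact hne (hcut u (Finset.mem_sdiff.mpr ⟨h.supp u v hpos, hu⟩) v hv hpos)

/-- Deleting an edge at the root of a tree leaves two components. -/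
theorem RootedWTree.exists_component (h : RootedWTree σ a A r μ) (hrc : 0 < μ r c) :
    ∃ D ⊆ A, c ∈ D ∧ r ∉ D ∧ ∀ u ∈ A \ D, ∀ v ∈ D, 0 < μ u v → u = r ∧ v = c := by
  have hne : r ≠ c := by rintro rfl; exact h.bip _ _ hrc rfl
  have hcA : c ∈ A := h.supp c r (by rwa [h.symm])
  set ν : V → V → ℕ := fun u v => if (u = r ∧ v = c) ∨ (u = c ∧ v = r) then 0 else μ u v with hν
  have hνsymm : ∀ u v, ν u v = ν v u := by
    intro u v
    simp only [hν, h.symm u v]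
    congr 1
    simp only [eq_iff_iff]
    tauto
  have hνpairs : adjPairs ν A + 2 = adjPairs μ A := by
    have hsplit : ∀ u v, (if 0 < μ u v then 1 else 0) = (if 0 < ν u v then 1 else 0) +
        ((if u = r then (if v = c then 1 else 0) else 0) +
          (if u = c then (if v = r then 1 else 0) else 0)) := by
      intro u v
      simp only [hν]
      by_cases h1 : u = r ∧ v = c
      · obtain ⟨rfl, rfl⟩ := h1
        simp [hrc, hne]
      · by_cases h2 : u = c ∧ v = r
        · obtain ⟨rfl, rfl⟩ := h2
          have : 0 < μ u v := by rwa [h.symm]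
          simp [this, hne.symm]
        · have h3 : ¬(u = r ∧ v = c ∨ u = c ∧ v = r) := by tauto
          rw [if_neg h3, ← ite_and, ← ite_and, if_neg h1, if_neg h2, add_zero, add_zero]
    unfold adjPairs
    simp only [hsplit, Finset.sum_add_distrib]
    have e1 : ∑ u ∈ A, ∑ v ∈ A, (if u = r then (if v = c then 1 else 0) else 0) = 1 := by
      rw [Finset.sum_eq_single_of_mem r h.root_mem (by intro u _ hu; simp [hu])]
      simp [hcA]
    have e2 : ∑ u ∈ A, ∑ v ∈ A, (if u = c then (if v = r then 1 else 0) else 0) = 1 := by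
      rw [Finset.sum_eq_single_of_mem c hcA (by intro u _ hu; simp [hu])]
      simp [h.root_mem]
    rw [e1, e2]
  -- Without the edge between r and c there are too few edges for a connected graph; a set
  -- witnessing this, or its complement, is the component of c.
  have hnot : ¬CutConnected ν A := by
    intro hcon
    have := hcon.le_adjPairs hνsymm h.root_mem
    have := h.count
    omega
  unfold CutConnected at hnot
  push Not at hnot
  obtain ⟨S, hSA, hSne, hSA', hS⟩ := hnot
  have hcut : ∀ u ∈ S, ∀ v ∈ A \ S, 0 < μ u v → (u = r ∧ v = c) ∨ (u = c ∧ v = r) := by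
    intro u hu v hv huv
    by_contra hcon
    have := hS u hu v hv
    simp only [hν, if_neg hcon] at this
    omega
  obtain ⟨u, hu, v, hv, huv⟩ := h.conn S hSA hSne hSA'
  rcases hcut u hu v hv huv with ⟨rfl, rfl⟩ | ⟨rfl, rfl⟩
  · refine ⟨A \ S, Finset.sdiff_subset, hv, fun h' => (Finset.mem_sdiff.mp h').2 hu, ?_⟩
    intro x hx y hy hxy
    rw [Finset.sdiff_sdiff_eq_self hSA] at hx
    rcases hcut x hx y hy hxy with h1 | ⟨rfl, rfl⟩
    · exact h1
    · exact absurd hx (Finset.mem_sdiff.mp hv).2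
  · refine ⟨S, hSA, hu, (Finset.mem_sdiff.mp hv).2, ?_⟩
    intro x hx y hy hxy
    rcases hcut y hy x hx (by rwa [h.symm]) with ⟨rfl, rfl⟩ | ⟨rfl, rfl⟩
    · exact absurd hy (Finset.mem_sdiff.mp hv).2
    · exact ⟨rfl, rfl⟩

/-- Both parts are connected, so each has at least one edge fewer than vertices; the edge count of
the whole forces equality in both. After the cut, c lacks exactly the weight of the deleted edge,
which is therefore visible in the excess of D. -/
theorem RootedWTree.exists_split (h : RootedWTree σ a A r μ) (hrc : 0 < μ r c) :
    ∃ D ⊆ A, c ∈ D ∧ r ∉ D ∧ RootedWTree σ a (A \ D) r (restrictEdges μ (A \ D)) ∧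
      RootedWTree σ a D c (restrictEdges μ D) ∧ excess σ a D = colorSign σ c * μ r c ∧
      joinEdges (restrictEdges μ (A \ D)) (restrictEdges μ D) r c (μ r c) = μ := by
  obtain ⟨D, hDA, hcD, hrD, hcut⟩ := h.exists_component hrc
  have hrC : r ∈ A \ D := Finset.mem_sdiff.mpr ⟨h.root_mem, hrD⟩
  have hcutD : ∀ u ∈ A \ D, ∀ v ∈ D, 0 < μ u v → v = c := fun u hu v hv huv =>
    (hcut u hu v hv huv).2
  have hcutC : ∀ u ∈ A \ (A \ D), ∀ v ∈ A \ D, 0 < μ u v → v = r := by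
    intro u hu v hv huv
    rw [Finset.sdiff_sdiff_eq_self hDA] at hu
    exact (hcut v hv u hu (by rwa [h.symm])).1
  have hE := adjPairs_union Finset.sdiff_disjoint hrC hcD h.symm hrc hcut
  rw [Finset.sdiff_union_of_subset hDA] at hE
  have h1 := (h.conn.of_attached h.symm hDA hcD hcutD).le_adjPairs h.symm hcD
  have h2 := (h.conn.of_attached h.symm Finset.sdiff_subset hrC hcutC).le_adjPairs h.symm hrC
  have h3 := h.count
  have h4 := Finset.card_sdiff_add_card_eq_card hDA
  have hTD : RootedWTree σ a D c (restrictEdges μ D) :=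
    h.restrict hDA hcD hcutD (fun h => absurd h hrD) (by omega)
  have hTC : RootedWTree σ a (A \ D) r (restrictEdges μ (A \ D)) :=
    h.restrict Finset.sdiff_subset hrC hcutC (fun _ => rfl) (by omega)
  refine ⟨D, hDA, hcD, hrD, hTC, hTD, ?_, ?_⟩
  · rw [hTD.excess_eq]
    have hcr : c ≠ r := by rintro rfl; exact hrD hcD
    have hsum := h.sum_eq c (hDA hcD) hcr
    have hdiff : ∑ u, μ c u = ∑ u, restrictEdges μ D c u + μ c r := by
      have : ∀ u, μ c u = restrictEdges μ D c u + if u = r then μ c r else 0 := by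
        intro u
        by_cases hu : u ∈ D
        · rw [restrictEdges, if_pos ⟨hcD, hu⟩, if_neg (by rintro rfl; exact hrD hu), add_zero]
        · rw [restrictEdges, if_neg (fun h => hu h.2), zero_add]
          split_ifs with hur
          · rw [hur]
          · by_contra h0
            have hpos : 0 < μ u c := by rw [h.symm]; omega
            exact hur (hcut u (Finset.mem_sdiff.mpr ⟨h.supp u c hpos, hu⟩) c hcD hpos).1
      rw [Finset.sum_congr rfl fun u _ => this u, Finset.sum_add_distrib, Finset.sum_ite_eq',
        if_pos (Finset.mem_univ _)]
    rw [← hsum, hdiff, h.symm r c]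
    push_cast
    ring
  · funext u v
    rw [joinEdges]
    split_ifs with hcond
    · rcases hcond with ⟨rfl, rfl⟩ | ⟨rfl, rfl⟩
      · rfl
      · exact h.symm _ _
    · have hz : ∀ x y, 0 < μ x y → x ∈ A \ D → y ∈ D → (x = r ∧ y = c) := fun x y hxy hx hy =>
        hcut x hx y hy hxy
      rcases Nat.eq_zero_or_pos (μ u v) with h0 | h0
      · simp [restrictEdges, h0]
      · have huA := h.supp u v h0
        have h0' : 0 < μ v u := by rwa [h.symm]
        have hvA := h.supp v u h0'
        by_cases hu : u ∈ D <;> by_cases hv : v ∈ D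
        · simp [restrictEdges, hu, hv]
        · exact absurd (Or.inr ((hz v u h0' (Finset.mem_sdiff.mpr ⟨hvA, hv⟩) hu).symm)) hcond
        · exact absurd (Or.inl (hz u v h0 (Finset.mem_sdiff.mpr ⟨huA, hu⟩) hv)) hcond
        · simp [restrictEdges, hu, hv, huA, hvA]

/-- The data of two trees which can be joined by an edge between their roots. -/
structure Joinable (σ : V → Bool) (a : V → ℕ) (A D : Finset V) (r c : V)
    (μ₁ μ₂ : V → V → ℕ) (m : ℕ) : Prop where
  sub : D ⊆ A
  tree₁ : RootedWTree σ a (A \ D) r μ₁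
  tree₂ : RootedWTree σ a D c μ₂
  color : σ r ≠ σ c
  excess : excess σ a D = colorSign σ c * m
  pos : 0 < m

namespace Joinable

variable {m : ℕ} (h : Joinable σ a A D r c μ₁ μ₂ m)
include h

theorem root_notMem : r ∉ D := (Finset.mem_sdiff.mp h.tree₁.root_mem).2

theorem join_symm (u v : V) : joinEdges μ₁ μ₂ r c m u v = joinEdges μ₁ μ₂ r c m v u := by
  simp only [joinEdges, h.tree₁.symm u v, h.tree₂.symm u v]
  congr 1
  simp only [eq_iff_iff]
  tauto

theorem join_root : joinEdges μ₁ μ₂ r c m r c = m := by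
  rw [joinEdges, if_pos (Or.inl ⟨rfl, rfl⟩)]

theorem join_left {v : V} (hv : v ∈ A \ D) (hvr : v ≠ r) (u : V) :
    joinEdges μ₁ μ₂ r c m v u = μ₁ v u := by
  have hvD := (Finset.mem_sdiff.mp hv).2
  rw [joinEdges, if_neg, h.tree₂.eq_zero_left hvD, add_zero]
  rintro (⟨h1, _⟩ | ⟨rfl, _⟩)
  · exact hvr h1
  · exact hvD h.tree₂.root_mem

theorem join_right {v : V} (hv : v ∈ D) (hvc : v ≠ c) (u : V) :
    joinEdges μ₁ μ₂ r c m v u = μ₂ v u := by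
  have hvC : v ∉ A \ D := fun h' => (Finset.mem_sdiff.mp h').2 hv
  rw [joinEdges, if_neg, h.tree₁.eq_zero_left hvC, zero_add]
  rintro (⟨rfl, _⟩ | ⟨h1, _⟩)
  · exact h.root_notMem hv
  · exact hvc h1

theorem join_left_root (u : V) :
    joinEdges μ₁ μ₂ r c m r u = μ₁ r u + if u = c then m else 0 := by
  have hcC : c ∉ A \ D := fun h' => (Finset.mem_sdiff.mp h').2 h.tree₂.root_mem
  by_cases hu : u = c
  · subst hu
    rw [h.join_root, h.tree₁.eq_zero_right hcC, if_pos rfl, zero_add]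
  · rw [joinEdges, if_neg, h.tree₂.eq_zero_left h.root_notMem, if_neg hu]
    rintro (⟨_, h1⟩ | ⟨h1, _⟩)
    · exact hu h1
    · exact h.color (by rw [h1])

theorem join_right_root (u : V) :
    joinEdges μ₁ μ₂ r c m c u = μ₂ c u + if u = r then m else 0 := by
  have hcC : c ∉ A \ D := fun h' => (Finset.mem_sdiff.mp h').2 h.tree₂.root_mem
  by_cases hu : u = r
  · subst hu
    rw [h.join_symm, h.join_root, h.tree₂.eq_zero_right h.root_notMem, if_pos rfl, zero_add]
  · rw [joinEdges, if_neg, h.tree₁.eq_zero_left hcC, if_neg hu, zero_add, add_zero]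
    rintro (⟨h1, _⟩ | ⟨_, h1⟩)
    · exact h.color (by rw [h1])
    · exact hu h1

theorem join_eq_left {u v : V} (hu : u ∈ A \ D) (hv : v ∈ A \ D) :
    joinEdges μ₁ μ₂ r c m u v = μ₁ u v := by
  by_cases hur : u = r
  · subst hur
    rw [h.join_left_root, if_neg, add_zero]
    rintro rfl
    exact (Finset.mem_sdiff.mp hv).2 h.tree₂.root_mem
  · exact h.join_left hu hur v

theorem join_eq_right {u v : V} (hu : u ∈ D) (hv : v ∈ D) :
    joinEdges μ₁ μ₂ r c m u v = μ₂ u v := by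
  by_cases huc : u = c
  · subst huc
    rw [h.join_right_root, if_neg, add_zero]
    rintro rfl
    exact h.root_notMem hv
  · exact h.join_right hu huc v

theorem join_cut {u v : V} (hu : u ∈ A \ D) (hv : v ∈ D)
    (huv : 0 < joinEdges μ₁ μ₂ r c m u v) : u = r ∧ v = c := by
  by_contra hcon
  rw [joinEdges, if_neg, h.tree₁.eq_zero_right (fun h' => (Finset.mem_sdiff.mp h').2 hv),
    h.tree₂.eq_zero_left (Finset.mem_sdiff.mp hu).2] at huv
  · exact absurd huv (lt_irrefl _)
  · rintro (h1 | ⟨rfl, _⟩)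
    · exact hcon h1
    · exact (Finset.mem_sdiff.mp hu).2 h.tree₂.root_mem

theorem restrict_left : restrictEdges (joinEdges μ₁ μ₂ r c m) (A \ D) = μ₁ := by
  funext u v
  rw [restrictEdges]
  split_ifs with hc
  · exact h.join_eq_left hc.1 hc.2
  · by_cases hu : u ∈ A \ D
    · rw [h.tree₁.eq_zero_right fun hv => hc ⟨hu, hv⟩]
    · rw [h.tree₁.eq_zero_left hu]

theorem restrict_right : restrictEdges (joinEdges μ₁ μ₂ r c m) D = μ₂ := by
  funext u v
  rw [restrictEdges]
  split_ifs with hc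
  · exact h.join_eq_right hc.1 hc.2
  · by_cases hu : u ∈ D
    · rw [h.tree₂.eq_zero_right fun hv => hc ⟨hu, hv⟩]
    · rw [h.tree₂.eq_zero_left hu]

theorem joined_conn : CutConnected (joinEdges μ₁ μ₂ r c m) A := by
  intro S hSA hne hSA'
  have part : ∀ T ⊆ A, ∀ ν, CutConnected ν T →
      (∀ u ∈ T, ∀ v ∈ T, joinEdges μ₁ μ₂ r c m u v = ν u v) → (S ∩ T).Nonempty → S ∩ T ≠ T →
      ∃ u ∈ S, ∃ v ∈ A \ S, 0 < joinEdges μ₁ μ₂ r c m u v := by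
    intro T hT ν hν hag h1 h2
    obtain ⟨u, hu, v, hv, huv⟩ := hν (S ∩ T) Finset.inter_subset_right h1 h2
    obtain ⟨hvT, hvS⟩ := Finset.mem_sdiff.mp hv
    obtain ⟨huS, huT⟩ := Finset.mem_inter.mp hu
    exact ⟨u, huS, v, Finset.mem_sdiff.mpr ⟨hT hvT, fun h' => hvS (Finset.mem_inter.mpr ⟨h', hvT⟩)⟩,
      by rwa [hag u huT v hvT]⟩
  have hcA : c ∈ A := h.sub h.tree₂.root_mem
  have hrA : r ∈ A := (Finset.mem_sdiff.mp h.tree₁.root_mem).1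
  by_cases hrS : r ∈ S
  · by_cases hcS : c ∈ S
    · obtain ⟨x, hxA, hxS⟩ : ∃ x ∈ A, x ∉ S := by
        by_contra hcon
        push Not at hcon
        exact hSA' (Finset.Subset.antisymm hSA hcon)
      by_cases hxD : x ∈ D
      · exact part D h.sub μ₂ h.tree₂.conn (fun u hu v hv => h.join_eq_right hu hv)
          ⟨c, Finset.mem_inter.mpr ⟨hcS, h.tree₂.root_mem⟩⟩
          (fun he => hxS (Finset.inter_eq_right.mp he hxD))
      · have hxC : x ∈ A \ D := Finset.mem_sdiff.mpr ⟨hxA, hxD⟩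
        exact part (A \ D) Finset.sdiff_subset μ₁ h.tree₁.conn
          (fun u hu v hv => h.join_eq_left hu hv)
          ⟨r, Finset.mem_inter.mpr ⟨hrS, h.tree₁.root_mem⟩⟩
          (fun he => hxS (Finset.inter_eq_right.mp he hxC))
    · exact ⟨r, hrS, c, Finset.mem_sdiff.mpr ⟨hcA, hcS⟩, by rw [h.join_root]; exact h.pos⟩
  · by_cases hcS : c ∈ S
    · exact ⟨c, hcS, r, Finset.mem_sdiff.mpr ⟨hrA, hrS⟩, by
        rw [h.join_symm, h.join_root]; exact h.pos⟩
    · obtain ⟨x, hxS⟩ := hne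
      by_cases hxD : x ∈ D
      · exact part D h.sub μ₂ h.tree₂.conn (fun u hu v hv => h.join_eq_right hu hv)
          ⟨x, Finset.mem_inter.mpr ⟨hxS, hxD⟩⟩
          (fun he => hcS (Finset.inter_eq_right.mp he h.tree₂.root_mem))
      · have hxC : x ∈ A \ D := Finset.mem_sdiff.mpr ⟨hSA hxS, hxD⟩
        exact part (A \ D) Finset.sdiff_subset μ₁ h.tree₁.conn
          (fun u hu v hv => h.join_eq_left hu hv)
          ⟨x, Finset.mem_inter.mpr ⟨hxS, hxC⟩⟩
          (fun he => hrS (Finset.inter_eq_right.mp he h.tree₁.root_mem))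

/-- The new edge leaves all vertex weights unchanged except those of r, which is free, and of c,
where m supplies what was missing. -/
theorem tree : RootedWTree σ a A r (joinEdges μ₁ μ₂ r c m) := by
  have hcA : c ∈ A := h.sub h.tree₂.root_mem
  have hrA : r ∈ A := (Finset.mem_sdiff.mp h.tree₁.root_mem).1
  refine ⟨h.join_symm, ?_, ?_, h.joined_conn, ?_, hrA, ?_⟩
  · intro u v huv
    rw [joinEdges] at huv
    split_ifs at huv with hc
    · rcases hc with ⟨rfl, _⟩ | ⟨rfl, _⟩
      · exact hrA
      · exact hcA
    · rcases Nat.add_pos_iff_pos_or_pos.mp huv with h1 | h1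
      · exact Finset.sdiff_subset (h.tree₁.supp u v h1)
      · exact h.sub (h.tree₂.supp u v h1)
  · intro u v huv
    rw [joinEdges] at huv
    split_ifs at huv with hc
    · rcases hc with ⟨rfl, rfl⟩ | ⟨rfl, rfl⟩
      · exact h.color
      · exact h.color.symm
    · rcases Nat.add_pos_iff_pos_or_pos.mp huv with h1 | h1
      · exact h.tree₁.bip u v h1
      · exact h.tree₂.bip u v h1
  · have hE := adjPairs_union Finset.sdiff_disjoint h.tree₁.root_mem h.tree₂.root_mem
      h.join_symm (by rw [h.join_root]; exact h.pos) fun u hu v hv huv => h.join_cut hu hv huv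
    rw [Finset.sdiff_union_of_subset h.sub,
      adjPairs_congr (ν := μ₁) fun u hu v hv => h.join_eq_left hu hv,
      adjPairs_congr (ν := μ₂) fun u hu v hv => h.join_eq_right hu hv] at hE
    have h1 := h.tree₁.count
    have h2 := h.tree₂.count
    have h3 := Finset.card_sdiff_add_card_eq_card h.sub
    omega
  · intro v hv hne
    by_cases hvD : v ∈ D
    · by_cases hvc : v = c
      · subst hvc
        simp only [h.join_right_root, Finset.sum_add_distrib, Finset.sum_ite_eq',
          Finset.mem_univ, if_true]
        -- Two expressions for the excess of D: the weight missing at c, and m.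
        have h1 := h.tree₂.excess_eq
        rw [h.excess] at h1
        have h2 := congrArg (colorSign σ v * ·) h1
        simp only [← mul_assoc, colorSign_mul_self, one_mul] at h2
        omega
      · simp only [h.join_right hvD hvc]
        exact h.tree₂.sum_eq v hvD hvc
    · have hvC : v ∈ A \ D := Finset.mem_sdiff.mpr ⟨hv, hvD⟩
      simp only [h.join_left hvC hne]
      exact h.tree₁.sum_eq v hvC hne

theorem wdeg_left {v : V} (hv : v ∈ A \ D) (hvr : v ≠ r) :
    wdeg (joinEdges μ₁ μ₂ r c m) v = wdeg μ₁ v := by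
  simp only [wdeg, h.join_left hv hvr]

theorem wdeg_right {v : V} (hv : v ∈ D) (hvc : v ≠ c) :
    wdeg (joinEdges μ₁ μ₂ r c m) v = wdeg μ₂ v := by
  simp only [wdeg, h.join_right hv hvc]

theorem wdeg_root : wdeg (joinEdges μ₁ μ₂ r c m) r = wdeg μ₁ r + 1 := by
  have hcC : c ∉ A \ D := fun h' => (Finset.mem_sdiff.mp h').2 h.tree₂.root_mem
  have : ∀ u, (if 0 < joinEdges μ₁ μ₂ r c m r u then 1 else 0) =
      (if 0 < μ₁ r u then 1 else 0) + if u = c then 1 else 0 := by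
    intro u
    rw [h.join_left_root]
    by_cases hu : u = c
    · subst hu
      simp [h.tree₁.eq_zero_right hcC, h.pos]
    · simp [hu]
  simp only [wdeg, this, Finset.sum_add_distrib, Finset.sum_ite_eq', Finset.mem_univ, if_true]

theorem wdeg_child : wdeg (joinEdges μ₁ μ₂ r c m) c = wdeg μ₂ c + 1 := by
  have : ∀ u, (if 0 < joinEdges μ₁ μ₂ r c m c u then 1 else 0) =
      (if 0 < μ₂ c u then 1 else 0) + if u = r then 1 else 0 := by
    intro u
    rw [h.join_right_root]
    by_cases hu : u = r
    · subst hu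
      simp [h.tree₂.eq_zero_right h.root_notMem, h.pos]
    · simp [hu]
  simp only [wdeg, this, Finset.sum_add_distrib, Finset.sum_ite_eq', Finset.mem_univ, if_true]

/-- If D were not contained in D', connectedness of D would give an edge inside D crossing the
boundary of D'. In the second decomposition the outer end of such an edge is r, which is not in D.
-/
theorem component_subset {D' : Finset V} {ν₁ ν₂ : V → V → ℕ} {m' : ℕ}
    (h' : Joinable σ a A D' r c ν₁ ν₂ m')
    (heq : joinEdges μ₁ μ₂ r c m = joinEdges ν₁ ν₂ r c m') : D ⊆ D' := by
  by_contra hD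
  have hne : D ∩ D' ≠ D := fun he => hD (Finset.inter_eq_left.mp he)
  obtain ⟨u, hu, v, hv, huv⟩ := h.tree₂.conn (D ∩ D') Finset.inter_subset_left
    ⟨c, Finset.mem_inter.mpr ⟨h.tree₂.root_mem, h'.tree₂.root_mem⟩⟩ hne
  obtain ⟨huD, huD'⟩ := Finset.mem_inter.mp hu
  obtain ⟨hvD, hv'⟩ := Finset.mem_sdiff.mp hv
  have hvD' : v ∉ D' := fun h1 => hv' (Finset.mem_inter.mpr ⟨hvD, h1⟩)
  rw [← h.join_eq_right huD hvD, heq, h'.join_symm] at huv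
  have := (h'.join_cut (Finset.mem_sdiff.mpr ⟨h.sub hvD, hvD'⟩) huD' huv).1
  exact h.root_notMem (this ▸ hvD)

theorem injective {D' : Finset V} {ν₁ ν₂ : V → V → ℕ} {m' : ℕ}
    (h' : Joinable σ a A D' r c ν₁ ν₂ m')
    (heq : joinEdges μ₁ μ₂ r c m = joinEdges ν₁ ν₂ r c m') : D = D' ∧ μ₁ = ν₁ ∧ μ₂ = ν₂ := by
  obtain rfl : D = D' := Finset.Subset.antisymm (h.component_subset h' heq)
    (h'.component_subset h heq.symm)
  exact ⟨rfl, by rw [← h.restrict_left, heq, h'.restrict_left],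
    by rw [← h.restrict_right, heq, h'.restrict_right]⟩

end Joinable

/-- Of the two ends of an edge at least one is not the root, and its prescribed weight bounds the
edge. This bound makes the set of trees finite. -/
theorem RootedWTree.le_sum (h : RootedWTree σ a A r μ) (u v : V) : μ u v ≤ ∑ w, a w := by
  have aux : ∀ u v, u ∈ A → u ≠ r → μ u v ≤ ∑ w, a w := by
    intro u v hu hur
    calc μ u v ≤ ∑ w, μ u w := Finset.single_le_sum (fun _ _ => Nat.zero_le _) (Finset.mem_univ v)
      _ = a u := h.sum_eq u hu hur
      _ ≤ ∑ w, a w := Finset.single_le_sum (fun _ _ => Nat.zero_le _) (Finset.mem_univ u)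
  rcases Nat.eq_zero_or_pos (μ u v) with h0 | h0
  · rw [h0]; exact Nat.zero_le _
  by_cases hu : u = r
  · rw [h.symm]
    refine aux v u (h.supp v u (by rwa [h.symm])) ?_
    rintro rfl
    exact h.bip u v h0 (by rw [hu])
  · exact aux u v (h.supp u v h0) hu

theorem finite_rootedWTree (σ : V → Bool) (a : V → ℕ) (A : Finset V) (r : V) :
    {μ | RootedWTree σ a A r μ}.Finite :=
  (Set.finite_Icc (0 : V → V → ℕ) fun _ _ => ∑ w, a w).subset fun _ hμ =>
    ⟨fun _ _ => Nat.zero_le _, fun u v => RootedWTree.le_sum hμ u v⟩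

/-- The finite set of weighted trees on `A` with root `r`. -/
noncomputable def rootedTrees (σ : V → Bool) (a : V → ℕ) (A : Finset V) (r : V) :
    Finset (V → V → ℕ) := (finite_rootedWTree σ a A r).toFinset

theorem mem_rootedTrees : μ ∈ rootedTrees σ a A r ↔ RootedWTree σ a A r μ :=
  (finite_rootedWTree σ a A r).mem_toFinset

/-- The number of plane structures on a tree with a marked corner at the root. -/
def planarWeight (μ : V → V → ℕ) (A : Finset V) (r : V) : ℕ :=
  (wdeg μ r).factorial * ∏ v ∈ A.erase r, (wdeg μ v - 1).factorial

/-- The number of plane weighted trees on `A` planted at `r`. -/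
noncomputable def rootedCount (σ : V → Bool) (a : V → ℕ) (A : Finset V) (r : V) : ℕ :=
  ∑ μ ∈ rootedTrees σ a A r, planarWeight μ A r

theorem rootedCount_singleton (σ : V → Bool) (a : V → ℕ) (r : V) :
    rootedCount σ a {r} r = 1 := by
  have h : rootedTrees σ a {r} r = {fun _ _ => 0} := by
    ext μ
    rw [mem_rootedTrees, Finset.mem_singleton]
    constructor
    · intro h
      funext u v
      by_contra h0
      have hpos := Nat.pos_of_ne_zero h0
      have hu := Finset.mem_singleton.mp (h.supp u v hpos)
      have hv := Finset.mem_singleton.mp (h.supp v u (by rwa [h.symm]))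
      exact h.bip u v hpos (by rw [hu, hv])
    · rintro rfl
      refine ⟨by simp, by simp, by simp, ?_, by simp [adjPairs], by simp, by simp⟩
      intro S hS hne hS'
      exact absurd ((Finset.subset_singleton_iff.mp hS).resolve_left hne.ne_empty) hS'
  rw [rootedCount, h, Finset.sum_singleton]
  simp [planarWeight, wdeg]

theorem RootedWTree.wdeg_pos (h : RootedWTree σ a A r μ) (hA : A ≠ {r}) : 0 < wdeg μ r := by
  obtain ⟨u, hu, v, _, huv⟩ := h.conn {r} (by simpa using h.root_mem) (by simp) hA.symm
  rw [Finset.mem_singleton.mp hu] at huv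
  have := Finset.single_le_sum (f := fun w => if 0 < μ r w then 1 else 0)
    (fun _ _ => Nat.zero_le _) (Finset.mem_univ v)
  rw [if_pos huv] at this
  exact this

/-- From d! = d · (d-1)! at the root: the marked corner singles out one of the d edges there, after
which every vertex carries a cyclic order. -/
theorem RootedWTree.planarWeight_eq (h : RootedWTree σ a A r μ) (hA : A ≠ {r}) :
    planarWeight μ A r =
      ∑ _c ∈ Finset.univ.filter (fun c => 0 < μ r c), ∏ v ∈ A, (wdeg μ v - 1).factorial := by
  rw [Finset.sum_const, smul_eq_mul, ← Finset.mul_prod_erase A _ h.root_mem, planarWeight,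
    ← mul_assoc]
  congr 1
  rw [Finset.card_filter]
  exact (Nat.mul_factorial_pred (h.wdeg_pos hA).ne').symm

/-- Joining raises the degrees of r and c by one, so (deg - 1)! after joining is deg! before,
exactly the factor of a root in `planarWeight`. -/
theorem Joinable.prod_factorial {m : ℕ} (h : Joinable σ a A D r c μ₁ μ₂ m) :
    ∏ v ∈ A, (wdeg (joinEdges μ₁ μ₂ r c m) v - 1).factorial =
      planarWeight μ₁ (A \ D) r * planarWeight μ₂ D c := by
  rw [← Finset.sdiff_union_of_subset h.sub, Finset.prod_union Finset.sdiff_disjoint,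
    Finset.sdiff_union_of_subset h.sub,
    ← Finset.mul_prod_erase _ _ h.tree₁.root_mem, ← Finset.mul_prod_erase _ _ h.tree₂.root_mem,
    h.wdeg_root, h.wdeg_child, planarWeight, planarWeight, Nat.add_sub_cancel, Nat.add_sub_cancel]
  congr 2
  · refine Finset.prod_congr rfl fun v hv => ?_
    rw [h.wdeg_left (Finset.mem_of_mem_erase hv) (Finset.ne_of_mem_erase hv)]
  · refine Finset.prod_congr rfl fun v hv => ?_
    rw [h.wdeg_right (Finset.mem_of_mem_erase hv) (Finset.ne_of_mem_erase hv)]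

theorem colorSign_mul_natAbs {x : ℤ} (h : 0 < colorSign σ c * x) :
    x = colorSign σ c * x.natAbs := by
  unfold colorSign at *
  split_ifs at * <;> omega

/-- Rooted trees are built from two smaller ones by joining their roots. -/
theorem rootedCount_eq_sum (hA : A ≠ {r}) :
    rootedCount σ a A r = ∑ D ∈ A.powerset, ∑ c ∈ D,
      if σ r ≠ σ c ∧ 0 < colorSign σ c * excess σ a D then
        rootedCount σ a (A \ D) r * rootedCount σ a D c else 0 := by
  have hR : (∑ D ∈ A.powerset, ∑ c ∈ D,
      if σ r ≠ σ c ∧ 0 < colorSign σ c * excess σ a D then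
        rootedCount σ a (A \ D) r * rootedCount σ a D c else 0) =
      ∑ x ∈ A.powerset.sigma fun D =>
          (D.filter fun c => σ r ≠ σ c ∧ 0 < colorSign σ c * excess σ a D).sigma fun c =>
            rootedTrees σ a (A \ D) r ×ˢ rootedTrees σ a D c,
        planarWeight x.2.2.1 (A \ x.1) r * planarWeight x.2.2.2 x.1 x.2.1 := by
    rw [Finset.sum_sigma]
    refine Finset.sum_congr rfl fun D _ => ?_
    rw [Finset.sum_sigma, Finset.sum_filter]
    refine Finset.sum_congr rfl fun c _ => ?_
    simp only [Finset.sum_product, rootedCount, Finset.sum_mul_sum]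
  have hL : rootedCount σ a A r =
      ∑ x ∈ (rootedTrees σ a A r).sigma fun μ => Finset.univ.filter fun c => 0 < μ r c,
        ∏ v ∈ A, (wdeg x.1 v - 1).factorial := by
    rw [Finset.sum_sigma, rootedCount]
    exact Finset.sum_congr rfl fun μ hμ => (mem_rootedTrees.mp hμ).planarWeight_eq hA
  have hjoin : ∀ x ∈ A.powerset.sigma fun D =>
      (D.filter fun c => σ r ≠ σ c ∧ 0 < colorSign σ c * excess σ a D).sigma fun c =>
        rootedTrees σ a (A \ D) r ×ˢ rootedTrees σ a D c,
      Joinable σ a A x.1 r x.2.1 x.2.2.1 x.2.2.2 (excess σ a x.1).natAbs := by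
    rintro ⟨D, c, μ₁, μ₂⟩ hx
    simp only [Finset.mem_sigma, Finset.mem_powerset, Finset.mem_filter, Finset.mem_product,
      mem_rootedTrees] at hx
    obtain ⟨hD, ⟨hc, hσ, hX⟩, h1, h2⟩ := hx
    refine ⟨hD, h1, h2, hσ, colorSign_mul_natAbs hX, ?_⟩
    rw [Int.natAbs_pos]
    rintro h0
    change excess σ a D = 0 at h0
    rw [h0, mul_zero] at hX
    exact lt_irrefl _ hX
  rw [hR, hL]
  symm
  -- The weight of the joining edge is not part of the data: it has to be the absolute value of the
  -- excess of D.
  refine Finset.sum_nbij (fun x => ⟨joinEdges x.2.2.1 x.2.2.2 r x.2.1 (excess σ a x.1).natAbs,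
    x.2.1⟩) ?_ ?_ ?_ ?_
  · intro x hx
    have h := hjoin x hx
    simp only [Finset.mem_sigma, mem_rootedTrees, Finset.mem_filter, Finset.mem_univ, true_and]
    exact ⟨h.tree, by rw [h.join_root]; exact h.pos⟩
  · intro x hx y hy hxy
    have h := hjoin x hx
    have h' := hjoin y hy
    obtain ⟨D, c, μ₁, μ₂⟩ := x
    obtain ⟨D', c', ν₁, ν₂⟩ := y
    simp only [Sigma.mk.injEq, heq_eq_eq] at hxy
    obtain ⟨hxy, rfl⟩ := hxy
    obtain ⟨rfl, rfl, rfl⟩ := h.injective h' hxy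
    rfl
  · rintro ⟨μ, c⟩ hx
    simp only [Finset.coe_sigma, Set.mem_sigma_iff, Finset.mem_coe, mem_rootedTrees,
      Finset.mem_filter, Finset.mem_univ, true_and] at hx
    obtain ⟨hμ, hrc⟩ := hx
    obtain ⟨D, hDA, hcD, hrD, hTC, hTD, hX, hjoin'⟩ := hμ.exists_split hrc
    have habs : (excess σ a D).natAbs = μ r c := by
      rw [hX]; unfold colorSign; split_ifs <;> simp
    refine ⟨⟨D, c, restrictEdges μ (A \ D), restrictEdges μ D⟩, ?_, ?_⟩
    · simp only [Finset.coe_sigma, Set.mem_sigma_iff, Finset.mem_coe, Finset.mem_powerset,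
        Finset.mem_filter, Finset.mem_product, mem_rootedTrees]
      refine ⟨hDA, ⟨hcD, hμ.bip r c hrc, ?_⟩, hTC, hTD⟩
      rw [hX, ← mul_assoc, colorSign_mul_self, one_mul]
      exact_mod_cast hrc
    · simp only [habs, hjoin']
  · intro x hx
    exact (hjoin x hx).prod_factorial.symm

/-- The number of plane weighted trees on `A` planted at a vertex of color `s`. -/
noncomputable def colorCount (σ : V → Bool) (a : V → ℕ) (s : Bool) (A : Finset V) : ℕ :=
  ∑ r ∈ A with σ r = s, rootedCount σ a A r

theorem rootedCount_eq_zero (hr : r ∉ A) : rootedCount σ a A r = 0 := by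
  rw [rootedCount, Finset.sum_eq_zero]
  intro μ hμ
  exact absurd (mem_rootedTrees.mp hμ).root_mem hr

/-- In the recursion for a single root, c has the opposite color, so the sign condition depends on s
and D only. The sums over r and over c then separate. -/
theorem colorCount_eq_sum (s : Bool) (hA : A.card ≠ 1) :
    colorCount σ a s A = ∑ D ∈ A.powerset,
      if 0 < (if s then -1 else 1) * excess σ a D then
        colorCount σ a s (A \ D) * colorCount σ a (!s) D else 0 := by
  rw [colorCount, Finset.sum_congr rfl fun r _ => rootedCount_eq_sum (r := r)
    (fun h => hA (by rw [h, Finset.card_singleton])), Finset.sum_comm]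
  refine Finset.sum_congr rfl fun D hD => ?_
  have hDA := Finset.mem_powerset.mp hD
  have h1 : colorCount σ a s (A \ D) = ∑ r ∈ A with σ r = s, rootedCount σ a (A \ D) r := by
    rw [colorCount]
    refine Finset.sum_subset (Finset.filter_subset_filter _ Finset.sdiff_subset) ?_
    intro r hr hr'
    refine rootedCount_eq_zero fun h => hr' ?_
    exact Finset.mem_filter.mpr ⟨h, (Finset.mem_filter.mp hr).2⟩
  by_cases hX : 0 < (if s then -1 else 1) * excess σ a D
  · rw [if_pos hX, h1, colorCount, Finset.sum_mul_sum]
    refine Finset.sum_congr rfl fun r hr => ?_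
    rw [Finset.sum_filter]
    refine Finset.sum_congr rfl fun c _ => ?_
    have hrs := (Finset.mem_filter.mp hr).2
    refine if_congr ?_ rfl rfl
    rw [hrs]
    unfold colorSign
    cases s <;> cases hc : σ c <;> simp_all
  · rw [if_neg hX]
    refine Finset.sum_eq_zero fun r hr => Finset.sum_eq_zero fun c _ => if_neg ?_
    have hrs := (Finset.mem_filter.mp hr).2
    rw [hrs]
    unfold colorSign
    cases s <;> cases hc : σ c <;> simp_all

theorem colorCount_singleton (s : Bool) (v : V) :
    colorCount σ a s {v} = if σ v = s then 1 else 0 := by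
  rw [colorCount, Finset.filter_singleton]
  split_ifs
  · rw [Finset.sum_singleton, rootedCount_singleton]
  · rfl

theorem excess_sdiff (hD : D ⊆ A) : excess σ a (A \ D) = excess σ a A - excess σ a D := by
  rw [excess, excess, excess, ← Finset.sum_sdiff hD]; ring

/-- The number of plane weighted trees on `A`, planted at a vertex with the color of the larger
weight, or rooted at an edge if the weights are balanced. -/
noncomputable def plantedCount (σ : V → Bool) (a : V → ℕ) (A : Finset V) : ℕ :=
  if 0 ≤ excess σ a A then colorCount σ a true A else colorCount σ a false A

/-- Planting at the heavier color is stable under cutting: the part cut off has the sign of its own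
root, and the part keeping the root then has the sign of that root. Both factors are again planted
counts, so one symmetric recursion covers both colors. -/
theorem plantedCount_eq (ha : ∀ v, 0 < a v) (A : Finset V) :
    plantedCount σ a A = (if A.card = 1 then 1 else 0) +
      ∑ D ∈ A.powerset, if 0 < excess σ a D ∧ excess σ a (A \ D) < 0 then
        plantedCount σ a D * plantedCount σ a (A \ D) else 0 := by
  by_cases hA : A.card = 1
  · obtain ⟨v, rfl⟩ := Finset.card_eq_one.mp hA
    rw [if_pos hA, Finset.sum_eq_zero, add_zero]
    · rw [plantedCount, colorCount_singleton, colorCount_singleton]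
      have := ha v
      rw [excess, Finset.sum_singleton, colorSign]
      cases σ v <;> simp [this.ne']
    · intro D hD
      rw [if_neg]
      rintro ⟨h1, h2⟩
      rcases Finset.subset_singleton_iff.mp (Finset.mem_powerset.mp hD) with rfl | rfl
      · simp [excess] at h1
      · simp [excess] at h2
  rw [if_neg hA, zero_add]
  by_cases hX : 0 ≤ excess σ a A
  · rw [plantedCount, if_pos hX, colorCount_eq_sum true hA]
    -- With a black root the part cut off is the negative one, whereas the sum is indexed by the
    -- positive part; hence the complement.
    refine Finset.sum_nbij' (fun D => A \ D) (fun D => A \ D) ?_ ?_ ?_ ?_ ?_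
    · intro D _; exact Finset.mem_powerset.mpr Finset.sdiff_subset
    · intro D _; exact Finset.mem_powerset.mpr Finset.sdiff_subset
    · intro D hD; exact Finset.sdiff_sdiff_eq_self (Finset.mem_powerset.mp hD)
    · intro D hD; exact Finset.sdiff_sdiff_eq_self (Finset.mem_powerset.mp hD)
    · intro D hD
      have hDA := Finset.mem_powerset.mp hD
      rw [Finset.sdiff_sdiff_eq_self hDA]
      have h1 := excess_sdiff (σ := σ) (a := a) hDA
      by_cases hneg : excess σ a D < 0
      · rw [if_pos (by simpa using hneg), if_pos ⟨by omega, hneg⟩, plantedCount, plantedCount,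
          if_pos (by omega), if_neg (by omega)]
        rfl
      · rw [if_neg (by simpa using hneg), if_neg (fun h => hneg h.2)]
  · rw [plantedCount, if_neg hX, colorCount_eq_sum false hA]
    refine Finset.sum_congr rfl fun D hD => ?_
    have hDA := Finset.mem_powerset.mp hD
    have h1 := excess_sdiff (σ := σ) (a := a) hDA
    by_cases hpos : 0 < excess σ a D
    · rw [if_pos (by simpa using hpos), if_pos ⟨hpos, by omega⟩, plantedCount, plantedCount,
        if_pos (by omega), if_neg (by omega), mul_comm]
      rfl
    · rw [if_neg (by simpa using hpos), if_neg (fun h => hpos h.1)]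

end WeightedTrees

/-! ### From counts on vertex sets to coefficients indexed by color type. -/

section WeightedTrees

set_option linter.unusedSectionVars false

variable {V : Type} [Fintype V] [DecidableEq V]

/-- The numbers of black and white vertices of `A`. -/
noncomputable def colorType (σ : V → Bool) (A : Finset V) : Fin 2 →₀ ℕ :=
  Finsupp.single 0 (A.filter fun v => σ v = true).card +
    Finsupp.single 1 (A.filter fun v => σ v = false).card

variable {σ : V → Bool} {A D : Finset V}

theorem colorType_zero (σ : V → Bool) (A : Finset V) :
    colorType σ A 0 = (A.filter fun v => σ v = true).card := by simp [colorType]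

theorem colorType_one (σ : V → Bool) (A : Finset V) :
    colorType σ A 1 = (A.filter fun v => σ v = false).card := by simp [colorType]

theorem card_eq_colorType (σ : V → Bool) (A : Finset V) :
    A.card = colorType σ A 0 + colorType σ A 1 := by
  rw [colorType_zero, colorType_one,
    ← Finset.card_filter_add_card_filter_not (s := A) (fun v => σ v = true)]
  simp only [Bool.not_eq_true]

theorem colorType_add_sdiff (hD : D ⊆ A) :
    colorType σ D + colorType σ (A \ D) = colorType σ A := by
  have key : ∀ s : Bool, (D.filter fun v => σ v = s).card +
      ((A \ D).filter fun v => σ v = s).card = (A.filter fun v => σ v = s).card := by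
    intro s
    rw [← Finset.card_union_of_disjoint (Finset.disjoint_filter_filter Finset.disjoint_sdiff),
      ← Finset.filter_union, Finset.union_sdiff_of_subset hD]
  apply exp_ext
  · rw [Finsupp.add_apply, colorType_zero, colorType_zero, colorType_zero, key]
  · rw [Finsupp.add_apply, colorType_one, colorType_one, colorType_one, key]

theorem excess_eq_excessHom {a : V → ℕ} {p q : ℕ} (ha : ∀ v, a v = if σ v then q else p)
    (A : Finset V) : excess σ a A = excessHom p q (colorType σ A) := by
  rw [excessHom_apply, colorType_zero, colorType_one, excess,
    ← Finset.sum_filter_add_sum_filter_not A (fun v => σ v = true)]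
  simp only [Bool.not_eq_true]
  rw [sub_eq_add_neg]
  congr 1
  · rw [Finset.sum_congr rfl (g := fun _ => (q : ℤ)), Finset.sum_const, nsmul_eq_mul]
    intro v hv
    rw [ha, colorSign, (Finset.mem_filter.mp hv).2]; simp
  · rw [Finset.sum_congr rfl (g := fun _ => -(p : ℤ)), Finset.sum_const, nsmul_eq_mul, mul_neg]
    intro v hv
    rw [ha, colorSign, (Finset.mem_filter.mp hv).2]; simp

/-- A subset is an independent choice of its black and of its white vertices. -/
theorem card_subsets_colorType (σ : V → Bool) (A : Finset V) {x : (Fin 2 →₀ ℕ) × (Fin 2 →₀ ℕ)}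
    (hx : x.1 + x.2 = colorType σ A) :
    (A.powerset.filter fun D => (colorType σ D, colorType σ (A \ D)) = x).card =
      (colorType σ A 0).choose (x.1 0) * (colorType σ A 1).choose (x.1 1) := by
  rw [colorType_zero, colorType_one, ← Finset.card_powersetCard, ← Finset.card_powersetCard,
    ← Finset.card_product]
  have hun : ∀ D : Finset V, (D.filter fun v => σ v = true) ∪ (D.filter fun v => σ v = false) =
      D := by
    intro D
    ext v
    cases h : σ v <;> simp [h]
  refine Finset.card_nbij' (fun D => (D.filter fun v => σ v = true, D.filter fun v => σ v = false))
    (fun y => y.1 ∪ y.2) ?_ ?_ ?_ ?_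
  · intro D hD
    obtain ⟨hDA, rfl⟩ := Finset.mem_filter.mp hD
    have hDA := Finset.mem_powerset.mp hDA
    simp only [Finset.coe_product, Set.mem_prod, Finset.mem_coe, Finset.mem_powersetCard]
    exact ⟨⟨Finset.filter_subset_filter _ hDA, (colorType_zero σ D).symm⟩,
      ⟨Finset.filter_subset_filter _ hDA, (colorType_one σ D).symm⟩⟩
  · rintro ⟨S, T⟩ hy
    simp only [Finset.coe_product, Set.mem_prod, Finset.mem_coe, Finset.mem_powersetCard] at hy
    obtain ⟨⟨hS, hScard⟩, hT, hTcard⟩ := hy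
    have hsub : S ∪ T ⊆ A :=
      Finset.union_subset (hS.trans (Finset.filter_subset _ _)) (hT.trans (Finset.filter_subset _ _))
    have hS' : ∀ v ∈ S, σ v = true := fun v hv => (Finset.mem_filter.mp (hS hv)).2
    have hT' : ∀ v ∈ T, σ v = false := fun v hv => (Finset.mem_filter.mp (hT hv)).2
    have e1 : ((S ∪ T).filter fun v => σ v = true) = S := by
      rw [Finset.filter_union, Finset.filter_true_of_mem hS', Finset.filter_false_of_mem,
        Finset.union_empty]
      intro v hv; simp [hT' v hv]
    have e2 : ((S ∪ T).filter fun v => σ v = false) = T := by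
      rw [Finset.filter_union, Finset.filter_true_of_mem hT', Finset.filter_false_of_mem,
        Finset.empty_union]
      intro v hv; simp [hS' v hv]
    have e3 : colorType σ (S ∪ T) = x.1 := by
      apply exp_ext
      · rw [colorType_zero, e1, hScard]
      · rw [colorType_one, e2, hTcard]
    refine Finset.mem_filter.mpr ⟨Finset.mem_powerset.mpr hsub, Prod.ext e3 ?_⟩
    have := colorType_add_sdiff (σ := σ) hsub
    rw [e3, ← hx] at this
    exact add_left_cancel this
  · intro D _
    exact hun D
  · rintro ⟨S, T⟩ hy
    simp only [Finset.coe_product, Set.mem_prod, Finset.mem_coe, Finset.mem_powersetCard] at hy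
    obtain ⟨⟨hS, _⟩, hT, _⟩ := hy
    have hS' : ∀ v ∈ S, σ v = true := fun v hv => (Finset.mem_filter.mp (hS hv)).2
    have hT' : ∀ v ∈ T, σ v = false := fun v hv => (Finset.mem_filter.mp (hT hv)).2
    refine Prod.ext ?_ ?_
    · simp only
      rw [Finset.filter_union, Finset.filter_true_of_mem hS', Finset.filter_false_of_mem,
        Finset.union_empty]
      intro v hv; simp [hT' v hv]
    · simp only
      rw [Finset.filter_union, Finset.filter_true_of_mem hT', Finset.filter_false_of_mem,
        Finset.empty_union]
      intro v hv; simp [hS' v hv]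

theorem sum_powerset_colorType (σ : V → Bool) (A : Finset V)
    (F : (Fin 2 →₀ ℕ) × (Fin 2 →₀ ℕ) → ℚ) :
    ∑ D ∈ A.powerset, F (colorType σ D, colorType σ (A \ D)) =
      ∑ x ∈ Finset.HasAntidiagonal.antidiagonal (colorType σ A),
        ((colorType σ A 0).choose (x.1 0) * (colorType σ A 1).choose (x.1 1) : ℕ) * F x := by
  rw [← Finset.sum_fiberwise_of_maps_to (s := A.powerset)
    (t := Finset.HasAntidiagonal.antidiagonal (colorType σ A))
    (g := fun D => (colorType σ D, colorType σ (A \ D)))]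
  · refine Finset.sum_congr rfl fun x hx => ?_
    rw [← card_subsets_colorType σ A (Finset.HasAntidiagonal.mem_antidiagonal.mp hx),
      ← nsmul_eq_mul, ← Finset.sum_const]
    refine Finset.sum_congr rfl fun D hD => ?_
    rw [(Finset.mem_filter.mp hD).2]
  · intro D hD
    exact Finset.HasAntidiagonal.mem_antidiagonal.mpr
      (colorType_add_sdiff (Finset.mem_powerset.mp hD))

/-- Both sides satisfy the same recursion: the binomial coefficients counting subsets of a given
type are absorbed by the factorials, as for exponential generating functions. The induction works
because parts of nonzero excess are nonempty, so both parts are proper. -/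
theorem plantedCount_eq_plantedCoeff {a : V → ℕ} {p q : ℕ} (hp : 0 < p) (hq : 0 < q)
    (ha : ∀ v, a v = if σ v then q else p) (A : Finset V) :
    (plantedCount σ a A : ℚ) = (colorType σ A 0).factorial * (colorType σ A 1).factorial *
      plantedCoeff (excessHom p q) (colorType σ A) := by
  have ha0 : ∀ v, 0 < a v := by
    intro v; rw [ha]; split_ifs
    · exact hq
    · exact hp
  induction A using Finset.strongInduction with
  | H A ih =>
    rw [plantedCount_eq ha0, plantedCoeff_eq, mul_add, Nat.cast_add]
    congr 1
    · rw [card_eq_colorType σ A]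
      split_ifs with h
      · have : colorType σ A 0 = 0 ∨ colorType σ A 0 = 1 := by omega
        rcases this with h0 | h0
        · rw [h0, show colorType σ A 1 = 1 by omega]; simp
        · rw [h0, show colorType σ A 1 = 0 by omega]; simp
      · simp
    · rw [Nat.cast_sum]
      have hF := sum_powerset_colorType σ A (fun x =>
        if 0 < excessHom p q x.1 ∧ excessHom p q x.2 < 0 then
          ((x.1 0).factorial * (x.1 1).factorial * plantedCoeff (excessHom p q) x.1) *
          ((x.2 0).factorial * (x.2 1).factorial * plantedCoeff (excessHom p q) x.2) else 0)
      have hL : ∀ D ∈ A.powerset, (((if 0 < excess σ a D ∧ excess σ a (A \ D) < 0 then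
          plantedCount σ a D * plantedCount σ a (A \ D) else 0 : ℕ)) : ℚ) =
          (fun x : (Fin 2 →₀ ℕ) × (Fin 2 →₀ ℕ) =>
        if 0 < excessHom p q x.1 ∧ excessHom p q x.2 < 0 then
          (((x.1 0).factorial : ℚ) * (x.1 1).factorial * plantedCoeff (excessHom p q) x.1) *
          ((x.2 0).factorial * (x.2 1).factorial * plantedCoeff (excessHom p q) x.2) else 0)
            (colorType σ D, colorType σ (A \ D)) := by
        intro D hD
        have hDA := Finset.mem_powerset.mp hD
        simp only [excess_eq_excessHom ha]
        split_ifs with h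
        · have hDne : D ≠ A := by
            rintro rfl
            rw [Finset.sdiff_self] at h
            simp [colorType] at h
          have hDe : D.Nonempty := by
            rw [Finset.nonempty_iff_ne_empty]
            rintro rfl
            simp [colorType] at h
          rw [Nat.cast_mul, ih D (Finset.ssubset_iff_subset_ne.mpr ⟨hDA, hDne⟩),
            ih (A \ D) (Finset.sdiff_ssubset hDA hDe)]
        · simp
      rw [Finset.sum_congr rfl hL, hF, Finset.mul_sum]
      refine Finset.sum_congr rfl fun x hx => ?_
      have hx := Finset.HasAntidiagonal.mem_antidiagonal.mp hx
      have h0 := DFunLike.congr_fun hx 0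
      have h1 := DFunLike.congr_fun hx 1
      rw [Finsupp.add_apply] at h0 h1
      split_ifs
      · rw [← h0, ← h1]
        have e0 := Nat.add_choose_mul_factorial_mul_factorial (x.1 0) (x.2 0)
        have e1 := Nat.add_choose_mul_factorial_mul_factorial (x.1 1) (x.2 1)
        rw [← e0, ← e1]
        rw [Nat.choose_symm_add, Nat.choose_symm_add]
        push_cast
        ring
      · simp

end WeightedTrees

/-! ### Counting cyclic orders. -/

section CyclicPermutations

theorem isCycleOn_univ_iff_cycleType {α : Type} [Fintype α] [DecidableEq α]
    (h2 : 2 ≤ Fintype.card α) (f : Equiv.Perm α) :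
    f.IsCycleOn Set.univ ↔ f.cycleType = {Fintype.card α} := by
  have hnt : (Set.univ : Set α).Nontrivial := by
    rw [Set.nontrivial_univ_iff]
    exact Fintype.one_lt_card_iff_nontrivial.mp h2
  constructor
  · intro h
    have hc : f.IsCycle := Equiv.Perm.isCycle_iff_exists_isCycleOn.mpr
      ⟨Set.univ, hnt, h, fun _ _ => Set.mem_univ _⟩
    rw [hc.cycleType]
    congr 1
    rw [← Finset.card_univ]
    congr 1
    ext x
    simpa using h.apply_ne hnt (Set.mem_univ x)
  · intro h
    have hc : f.IsCycle := by
      rw [← Equiv.Perm.card_cycleType_eq_one, h, Multiset.card_singleton]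
    have hs : f.support = Finset.univ := by
      rw [← Finset.card_eq_iff_eq_univ]
      have := hc.cycleType
      rw [h, Multiset.singleton_inj] at this
      exact this.symm
    have := hc.isCycleOn
    convert this
    ext x
    have hx : x ∈ f.support := by rw [hs]; exact Finset.mem_univ x
    simpa using Equiv.Perm.mem_support.mp hx

theorem card_isCycleOn_univ (α : Type) [Finite α] :
    Nat.card {f : Equiv.Perm α // f.IsCycleOn Set.univ} = (Nat.card α - 1).factorial := by
  classical
  have := Fintype.ofFinite α
  rw [Nat.card_eq_fintype_card (α := α)]
  by_cases h2 : 2 ≤ Fintype.card α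
  · rw [Nat.card_eq_fintype_card, Fintype.card_subtype]
    have := Equiv.Perm.card_of_cycleType_singleton (α := α) h2 le_rfl
    rw [Nat.choose_self, mul_one] at this
    rw [← this]
    congr 1
    ext f
    simp only [Finset.mem_filter, Finset.mem_univ, true_and]
    exact isCycleOn_univ_iff_cycleType h2 f
  -- Cycle types do not see fixed points, so at most one element is a separate case: the identity is
  -- the only permutation, and the truncated n - 1 is 0.
  · have hsub : Subsingleton α := Fintype.card_le_one_iff_subsingleton.mp (by omega)
    have h1 : Fintype.card α - 1 = 0 := by omega
    rw [h1, Nat.factorial_zero, Nat.card_eq_one_iff_unique]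
    exact ⟨⟨fun f g => Subtype.ext (Subsingleton.elim _ _)⟩,
      ⟨⟨1, Equiv.Perm.isCycleOn_of_subsingleton 1 _⟩⟩⟩

theorem isCycleOn_univ_permCongr {α β : Type} (e : α ≃ β) {f : Equiv.Perm α}
    (h : f.IsCycleOn Set.univ) : (e.permCongr f).IsCycleOn Set.univ := by
  refine ⟨Set.bijOn_univ.mpr (Equiv.bijective _), fun x _ y _ => ?_⟩
  obtain ⟨i, hi⟩ := h.2 (Set.mem_univ (e.symm x)) (Set.mem_univ (e.symm y))
  refine ⟨i, ?_⟩
  have : (e.permCongr f) ^ i = e.permCongr (f ^ i) := (map_zpow e.permCongrHom f i).symm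
  rw [this, Equiv.permCongr_apply, hi, Equiv.apply_symm_apply]

end CyclicPermutations

/-! ### Balanced trees: independence of the root. -/

section WeightedTrees

set_option linter.unusedSectionVars false

variable {V : Type} [Fintype V] [DecidableEq V]

variable {σ : V → Bool} {a : V → ℕ} {r r' : V} {μ : V → V → ℕ}

theorem RootedWTree.sum_eq_of_balanced (h : RootedWTree σ a Finset.univ r μ)
    (hX : excess σ a Finset.univ = 0) (v : V) : ∑ u, μ v u = a v := by
  by_cases hv : v = r
  · subst hv
    have h1 := h.excess_eq
    rw [hX] at h1
    have h2 := congrArg (colorSign σ v * ·) h1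
    simp only [← mul_assoc, colorSign_mul_self, one_mul, mul_zero] at h2
    omega
  · exact h.sum_eq v (Finset.mem_univ v) hv

/-- In the balanced case nothing is missing at the root, so no vertex is distinguished. -/
theorem RootedWTree.change_root (h : RootedWTree σ a Finset.univ r μ)
    (hX : excess σ a Finset.univ = 0) (r' : V) : RootedWTree σ a Finset.univ r' μ :=
  ⟨h.symm, h.supp, h.bip, h.conn, h.count, Finset.mem_univ r', fun v _ _ =>
    h.sum_eq_of_balanced hX v⟩

/-- Each edge has exactly one black end, so this sum counts edges. -/
theorem RootedWTree.sum_wdeg (h : RootedWTree σ a Finset.univ r μ) :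
    ∑ v with σ v = true, wdeg μ v = Fintype.card V - 1 := by
  have h1 : adjPairs μ Finset.univ = ∑ v, wdeg μ v := rfl
  have h2 : ∀ s : Bool, ∑ v with σ v = s, wdeg μ v =
      ∑ v with σ v = s, ∑ u with σ u = !s, if 0 < μ v u then 1 else 0 := by
    intro s
    refine Finset.sum_congr rfl fun v hv => ?_
    symm
    refine Finset.sum_subset (Finset.subset_univ _) fun u _ hu => if_neg fun hpos => hu ?_
    have := h.bip v u hpos
    rw [(Finset.mem_filter.mp hv).2] at this
    simp only [Finset.mem_filter, Finset.mem_univ, true_and]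
    cases s <;> cases hs : σ u <;> simp_all
  have h3 : ∑ v with σ v = true, wdeg μ v = ∑ v with σ v = false, wdeg μ v := by
    rw [h2, h2, Finset.sum_comm]
    refine Finset.sum_congr rfl fun u _ => Finset.sum_congr rfl fun v _ => ?_
    rw [h.symm v u]
  have h4 := Finset.sum_filter_add_sum_filter_not Finset.univ (fun v => σ v = true) (wdeg μ)
  simp only [Bool.not_eq_true] at h4
  have h5 := h.count
  rw [Finset.card_univ] at h5
  omega

/-- Zero excess means planting at black corners. There are as many of these as edges, and on each
tree the marked corner multiplies the number of cyclic structures by the degree of the root. -/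
theorem plantedCount_of_balanced (hX : excess σ a Finset.univ = 0)
    (hV : 1 < Fintype.card V) (r : V) :
    plantedCount σ a Finset.univ = (Fintype.card V - 1) *
      ∑ μ ∈ rootedTrees σ a Finset.univ r, ∏ v, (wdeg μ v - 1).factorial := by
  have hne : ∀ r : V, (Finset.univ : Finset V) ≠ {r} := by
    intro r h
    have := congrArg Finset.card h
    rw [Finset.card_univ, Finset.card_singleton] at this
    omega
  have hroot : ∀ r', rootedTrees σ a Finset.univ r' = rootedTrees σ a Finset.univ r := by
    intro r'
    ext μ
    rw [mem_rootedTrees, mem_rootedTrees]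
    exact ⟨fun h => h.change_root hX r, fun h => h.change_root hX r'⟩
  rw [plantedCount, if_pos hX.ge, colorCount]
  have h1 : ∀ r', rootedCount σ a Finset.univ r' =
      ∑ μ ∈ rootedTrees σ a Finset.univ r, wdeg μ r' * ∏ v, (wdeg μ v - 1).factorial := by
    intro r'
    rw [rootedCount, hroot r']
    refine Finset.sum_congr rfl fun μ hμ => ?_
    rw [← hroot r', mem_rootedTrees] at hμ
    rw [hμ.planarWeight_eq (hne r'), Finset.sum_const, smul_eq_mul, Finset.card_filter]
    rfl
  rw [Finset.sum_congr rfl fun r' _ => h1 r', Finset.sum_comm, Finset.mul_sum]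
  refine Finset.sum_congr rfl fun μ hμ => ?_
  rw [← Finset.sum_mul, (mem_rootedTrees.mp hμ).sum_wdeg]

end WeightedTrees

/-! ### Plane trees as weight matrices with rotations. -/

section BicoloredTrees

set_option linter.unusedSectionVars false

variable {P N : Type}

/-- The symmetric matrix of the weights of the edges. -/
def flowMatrix (M : P → N → ℕ) : P ⊕ N → P ⊕ N → ℕ
  | Sum.inl b, Sum.inr w => M b w
  | Sum.inr w, Sum.inl b => M b w
  | _, _ => 0

theorem flowMatrix_symm (M : P → N → ℕ) (u v : P ⊕ N) : flowMatrix M u v = flowMatrix M v u := by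
  cases u <;> cases v <;> rfl

theorem flowMatrix_injective : Function.Injective (flowMatrix : (P → N → ℕ) → _) := by
  intro M M' h
  funext b w
  exact congrFun (congrFun h (Sum.inl b)) (Sum.inr w)

/-- The graph of the edges of positive weight. -/
def supportGraph (M : P → N → ℕ) : SimpleGraph (P ⊕ N) where
  Adj u v := 0 < flowMatrix M u v
  symm := ⟨fun u v h => by rwa [flowMatrix_symm]⟩
  loopless := ⟨fun u h => by cases u <;> exact lt_irrefl _ h⟩

/-- Edges of a tree join different colors and are detected by positive weight, so the graph is
redundant data. -/
theorem WBPTree.graph_eq (T : WBPTree P N) : T.graph = supportGraph T.weight := by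
  ext u v
  change _ ↔ 0 < flowMatrix T.weight u v
  have hb : ∀ u v, T.graph.Adj u v → (completeBipartiteGraph P N).Adj u v :=
    fun u v h => T.bipartite h
  rcases u with b | w <;> rcases v with b' | w'
  · refine ⟨fun h => ?_, fun h => absurd h (lt_irrefl _)⟩
    simpa using hb _ _ h
  · exact (T.weight_pos_iff b w').symm
  · rw [SimpleGraph.adj_comm]
    exact (T.weight_pos_iff b' w).symm
  · refine ⟨fun h => ?_, fun h => absurd h (lt_irrefl _)⟩
    simpa using hb _ _ h

variable [Fintype P] [Fintype N] [DecidableEq P] [DecidableEq N]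

/-- In one direction the cut is the set of vertices reachable from u; in the other, a walk from S to
its complement crosses the boundary. -/
theorem cutConnected_iff_connected [Nonempty (P ⊕ N)] (M : P → N → ℕ) :
    CutConnected (flowMatrix M) Finset.univ ↔ (supportGraph M).Connected := by
  classical
  constructor
  · intro h
    refine ⟨fun u v => ?_⟩
    by_contra hv
    set S : Finset (P ⊕ N) := Finset.univ.filter fun x => (supportGraph M).Reachable u x
    have huS : u ∈ S := by simp [S]
    have hvS : v ∉ S := by simpa [S] using hv
    obtain ⟨x, hx, y, hy, hxy⟩ := h S (Finset.subset_univ S) ⟨u, huS⟩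
      (fun he => hvS (he ▸ Finset.mem_univ v))
    apply (Finset.mem_sdiff.mp hy).2
    have hx : (supportGraph M).Reachable u x := by simpa [S] using hx
    have hadj : (supportGraph M).Adj x y := hxy
    simpa [S] using hx.trans hadj.reachable
  · intro h S _ hne hS
    obtain ⟨u, hu⟩ := hne
    obtain ⟨v, hv⟩ : ∃ v, v ∉ S := by
      by_contra hcon
      push Not at hcon
      exact hS (Finset.eq_univ_of_forall hcon)
    obtain ⟨p⟩ := h.preconnected u v
    obtain ⟨d, _, hd1, hd2⟩ := p.exists_boundary_dart (S : Set (P ⊕ N)) hu hv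
    exact ⟨d.fst, hd1, d.snd, Finset.mem_sdiff.mpr ⟨Finset.mem_univ _, hd2⟩, d.adj⟩

theorem wdeg_flowMatrix (M : P → N → ℕ) (v : P ⊕ N) :
    wdeg (flowMatrix M) v = Nat.card ((supportGraph M).neighborSet v) := by
  classical
  rw [Nat.card_eq_fintype_card, SimpleGraph.card_neighborSet_eq_degree, wdeg,
    ← Finset.card_filter, ← SimpleGraph.card_neighborFinset_eq_degree]
  congr 1
  ext u
  simp only [Finset.mem_filter, Finset.mem_univ, true_and, SimpleGraph.mem_neighborFinset]
  rfl

theorem isTree_supportGraph_iff [Nonempty (P ⊕ N)] (M : P → N → ℕ) :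
    (supportGraph M).IsTree ↔ CutConnected (flowMatrix M) Finset.univ ∧
      adjPairs (flowMatrix M) Finset.univ + 2 = 2 * (Finset.univ : Finset (P ⊕ N)).card := by
  classical
  rw [SimpleGraph.isTree_iff_connected_and_card, cutConnected_iff_connected]
  refine and_congr_right fun _ => ?_
  have h1 : adjPairs (flowMatrix M) Finset.univ = ∑ v, (supportGraph M).degree v := by
    refine Finset.sum_congr rfl fun v _ => ?_
    rw [← SimpleGraph.card_neighborSet_eq_degree, ← Nat.card_eq_fintype_card]
    exact wdeg_flowMatrix M v
  rw [h1, SimpleGraph.sum_degrees_eq_twice_card_edges, Nat.card_eq_fintype_card,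
    Nat.card_eq_fintype_card, ← SimpleGraph.edgeFinset_card, Finset.card_univ]
  omega

/-- The weights of the edges of trees with prescribed weights of the vertices. -/
def IsTreeWeight (q p : ℕ) (M : P → N → ℕ) : Prop :=
  (supportGraph M).IsTree ∧ (∀ b, ∑ w, M b w = q) ∧ ∀ w, ∑ b, M b w = p

/-- The prescribed weights of the vertices. -/
def vertexWeight (q p : ℕ) (v : P ⊕ N) : ℕ := if Sum.isLeft v then q else p

theorem excess_univ (q p : ℕ) (h : Fintype.card P * q = Fintype.card N * p) :
    excess Sum.isLeft (vertexWeight q p) (Finset.univ : Finset (P ⊕ N)) = 0 := by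
  rw [excess, Fintype.sum_sum_type]
  simp only [colorSign, vertexWeight, Sum.isLeft_inl, Sum.isLeft_inr, if_true, Bool.false_eq_true,
    if_false, Finset.sum_const, Finset.card_univ, nsmul_eq_mul, one_mul, neg_mul]
  have : (Fintype.card P : ℤ) * q = Fintype.card N * p := by exact_mod_cast h
  linarith

theorem isTreeWeight_iff (q p : ℕ) (h : Fintype.card P * q = Fintype.card N * p) (r : P ⊕ N)
    (M : P → N → ℕ) : IsTreeWeight q p M ↔
      RootedWTree Sum.isLeft (vertexWeight q p) Finset.univ r (flowMatrix M) := by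
  have : Nonempty (P ⊕ N) := ⟨r⟩
  rw [IsTreeWeight, isTree_supportGraph_iff]
  have hl : ∀ b, ∑ u, flowMatrix M (Sum.inl b) u = ∑ w, M b w := by
    intro b
    rw [Fintype.sum_sum_type]
    simp [flowMatrix]
  have hr : ∀ w, ∑ u, flowMatrix M (Sum.inr w) u = ∑ b, M b w := by
    intro w
    rw [Fintype.sum_sum_type]
    simp [flowMatrix]
  constructor
  · rintro ⟨⟨h1, h2⟩, h3, h4⟩
    refine ⟨flowMatrix_symm M, fun u _ _ => Finset.mem_univ u, ?_, h1, h2, Finset.mem_univ r, ?_⟩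
    · intro u v huv
      rcases u with b | w <;> rcases v with b' | w' <;> simp [flowMatrix] at huv ⊢
    · rintro (b | w) _ _
      · rw [hl, h3]; rfl
      · rw [hr, h4]; rfl
  · intro hT
    have hs := hT.sum_eq_of_balanced (excess_univ q p h)
    exact ⟨⟨hT.conn, hT.count⟩, fun b => by rw [← hl, hs]; rfl, fun w => by rw [← hr, hs]; rfl⟩

theorem exists_flowMatrix_eq {a : P ⊕ N → ℕ} {A : Finset (P ⊕ N)} {r : P ⊕ N}
    {μ : P ⊕ N → P ⊕ N → ℕ} (h : RootedWTree Sum.isLeft a A r μ) : ∃ M, flowMatrix M = μ := by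
  refine ⟨fun b w => μ (Sum.inl b) (Sum.inr w), ?_⟩
  funext u v
  rcases u with b | w <;> rcases v with b' | w'
  · by_contra h0
    exact h.bip _ _ (Nat.pos_of_ne_zero (Ne.symm h0)) rfl
  · rfl
  · exact h.symm _ _
  · by_contra h0
    exact h.bip _ _ (Nat.pos_of_ne_zero (Ne.symm h0)) rfl

/-- Plane trees with prescribed weights of the vertices, on fixed sets of vertices. -/
def ConstWeightTree (P N : Type) [Fintype P] [Fintype N] (q p : ℕ) : Type :=
  {T : WBPTree P N // (∀ b, T.wtPos b = q) ∧ ∀ w, T.wtNeg w = p}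

/-- The tree with given edge weights and rotations. -/
def treeOfRotations (q p : ℕ) (x : Σ M : {M : P → N → ℕ // IsTreeWeight q p M},
    ∀ v, {f : Equiv.Perm ((supportGraph M.1).neighborSet v) // f.IsCycleOn Set.univ}) :
    ConstWeightTree P N q p :=
  ⟨{ graph := supportGraph x.1.1
     isTree := x.1.2.1
     bipartite := by
       intro u v h
       change 0 < flowMatrix x.1.1 u v at h
       rcases u with b | w <;> rcases v with b' | w' <;> simp [flowMatrix] at h ⊢
     rot := fun v => (x.2 v).1
     rot_isCycleOn := fun v => (x.2 v).2
     weight := x.1.1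
     weight_pos_iff := fun _ _ => Iff.rfl }, x.1.2.2.1, x.1.2.2.2⟩

theorem treeOfRotations_bijective (q p : ℕ) :
    Function.Bijective (treeOfRotations (P := P) (N := N) q p) := by
  constructor
  · rintro ⟨⟨M, hM⟩, f⟩ ⟨⟨M', hM'⟩, f'⟩ h
    have hval := congrArg Subtype.val h
    have hw : M = M' := congrArg WBPTree.weight hval
    subst hw
    congr 1
    have := (WBPTree.mk.injEq .. ▸ hval)
    obtain ⟨_, hrot, _⟩ := this
    funext v
    exact Subtype.ext (congrFun (eq_of_heq hrot) v)
  · rintro ⟨T, hq, hp⟩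
    have hG := T.graph_eq
    obtain ⟨graph, isTree, bip, rot, hrot, weight, hpos⟩ := T
    change graph = supportGraph weight at hG
    subst hG
    exact ⟨⟨⟨weight, isTree, hq, hp⟩, fun v => ⟨rot v, hrot v⟩⟩, rfl⟩

/-- The number of plane trees with constant weights of the black and of the white vertices. -/
theorem card_constWeightTree (q p : ℕ) (h : Fintype.card P * q = Fintype.card N * p)
    (r : P ⊕ N) :
    Finite (ConstWeightTree P N q p) ∧ Nat.card (ConstWeightTree P N q p) =
      ∑ μ ∈ rootedTrees Sum.isLeft (vertexWeight q p) (Finset.univ : Finset (P ⊕ N)) r,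
        ∏ v, (wdeg μ v - 1).factorial := by
  classical
  set g : {M : P → N → ℕ // IsTreeWeight q p M} →
      rootedTrees Sum.isLeft (vertexWeight q p) (Finset.univ : Finset (P ⊕ N)) r :=
    fun M => ⟨flowMatrix M.1, mem_rootedTrees.mpr ((isTreeWeight_iff q p h r M.1).mp M.2)⟩
    with hg
  have hgbij : Function.Bijective g := by
    constructor
    · intro M M' hM
      exact Subtype.ext (flowMatrix_injective (congrArg Subtype.val hM))
    · rintro ⟨μ, hμ⟩
      have hμ' := mem_rootedTrees.mp hμ
      obtain ⟨M, rfl⟩ := exists_flowMatrix_eq hμ'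
      exact ⟨⟨M, (isTreeWeight_iff q p h r M).mpr hμ'⟩, rfl⟩
  have hfin : Finite {M : P → N → ℕ // IsTreeWeight q p M} := Finite.of_injective g hgbij.1
  have := Fintype.ofFinite {M : P → N → ℕ // IsTreeWeight q p M}
  have hbij := treeOfRotations_bijective (P := P) (N := N) q p
  refine ⟨Finite.of_surjective _ hbij.2, ?_⟩
  rw [← Nat.card_congr (Equiv.ofBijective _ hbij), Nat.card_sigma]
  refine Eq.trans (Finset.sum_congr rfl fun M _ => ?_)
    ((hgbij.sum_comp fun x => ∏ v, (wdeg x.1 v - 1).factorial).trans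
      (Finset.sum_coe_sort _ fun μ : P ⊕ N → P ⊕ N → ℕ => ∏ v, (wdeg μ v - 1).factorial))
  rw [Nat.card_pi]
  refine Finset.prod_congr rfl fun v _ => ?_
  rw [card_isCycleOn_univ, ← wdeg_flowMatrix]

end BicoloredTrees

/-! ### Labelings by distinct labels. -/

section Labelings

theorem exists_labeling {α : Type} (m : Multiset α) :
    ∃ l : Fin (Multiset.card m) → α, Finset.univ.val.map l = m := by
  refine ⟨fun i => m.toList.get (Fin.cast (Multiset.length_toList m).symm i), ?_⟩
  rw [Fin.univ_val_map]
  conv_rhs => rw [← Multiset.coe_toList m]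
  exact congrArg _ (List.ext_getElem (by simp) (by simp))

theorem injective_of_map_nodup {α ι : Type} [Fintype ι] {m : Multiset α} (hm : m.Nodup)
    {l : ι → α} (hl : Finset.univ.val.map l = m) : Function.Injective l := by
  intro x y hxy
  rw [← hl] at hm
  exact Multiset.inj_on_of_nodup_map hm x (Finset.mem_univ x) y (Finset.mem_univ y) hxy

theorem exists_relabeling {α ι : Type} [Fintype ι] {m : Multiset α} (hm : m.Nodup)
    {l l' : ι → α} (hl : Finset.univ.val.map l = m) (hl' : Finset.univ.val.map l' = m) :
    ∃ f : ι ≃ ι, ∀ b, l' (f b) = l b := by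
  have hmem : ∀ b, ∃ x, l' x = l b := by
    intro b
    have h1 : l b ∈ Finset.univ.val.map l := Multiset.mem_map_of_mem l (Finset.mem_univ b)
    rw [hl, ← hl'] at h1
    obtain ⟨x, _, hx⟩ := Multiset.mem_map.mp h1
    exact ⟨x, hx⟩
  choose f hf using hmem
  have hinj : Function.Injective f := by
    intro x y hxy
    apply injective_of_map_nodup hm hl
    rw [← hf, ← hf, hxy]
  exact ⟨Equiv.ofBijective f (Finite.injective_iff_bijective.mp hinj), hf⟩

end Labelings

/-! ### Transport of plane trees along bijections of the vertices. -/

section Transport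

set_option linter.unusedSectionVars false

variable {P N : Type}

/-- The rotations of two trees live in different types and are therefore compared on the underlying
vertices. The graphs need no hypothesis, as the weights determine them. -/
theorem WBPTree.ext_of_rot {T T' : WBPTree P N} (hw : T.weight = T'.weight)
    (hrot : ∀ (v : P ⊕ N) (u : T.graph.neighborSet v) (u' : T'.graph.neighborSet v),
      (u : P ⊕ N) = u' → (T.rot v u : P ⊕ N) = T'.rot v u') : T = T' := by
  have h1 := T.graph_eq
  have h2 := T'.graph_eq
  obtain ⟨G, hT, hb, ρ, hρ, w, hp⟩ := T
  obtain ⟨G', hT', hb', ρ', hρ', w', hp'⟩ := T'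
  change w = w' at hw
  change G = supportGraph w at h1
  change G' = supportGraph w' at h2
  subst hw h1 h2
  congr 1
  funext v
  ext u
  exact hrot v u u rfl

theorem WBPTree.rot_congr (T : WBPTree P N) {v v' : P ⊕ N} (hv : v = v')
    {u : T.graph.neighborSet v} {u' : T.graph.neighborSet v'} (hu : (u : P ⊕ N) = u') :
    (T.rot v u : P ⊕ N) = T.rot v' u' := by
  subst hv
  rw [Subtype.ext hu]

/-- Transport of a tree along bijections of its black and of its white vertices. -/
def WBPTree.transport (T : WBPTree P N) (f : P ≃ P) (g : N ≃ N) : WBPTree P N where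
  graph := T.graph.comap (Equiv.sumCongr f g).symm
  isTree := (SimpleGraph.Iso.isTree_iff
    (SimpleGraph.Iso.comap (Equiv.sumCongr f g).symm T.graph)).mpr T.isTree
  bipartite := by
    intro u v h
    have := T.bipartite h
    rcases u with b | w <;> rcases v with b' | w' <;> simp at this ⊢
  rot v := ((SimpleGraph.Iso.comap (Equiv.sumCongr f g).symm T.graph).mapNeighborSet
    v).symm.permCongr (T.rot ((Equiv.sumCongr f g).symm v))
  rot_isCycleOn v := isCycleOn_univ_permCongr _ (T.rot_isCycleOn _)
  weight b w := T.weight (f.symm b) (g.symm w)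
  weight_pos_iff b w := T.weight_pos_iff (f.symm b) (g.symm w)

variable [Fintype P] [Fintype N]

theorem WBPTree.transport_wtPos (T : WBPTree P N) (f : P ≃ P) (g : N ≃ N) (b : P) :
    (T.transport f g).wtPos b = T.wtPos (f.symm b) :=
  Equiv.sum_comp g.symm fun w => T.weight (f.symm b) w

theorem WBPTree.transport_wtNeg (T : WBPTree P N) (f : P ≃ P) (g : N ≃ N) (w : N) :
    (T.transport f g).wtNeg w = T.wtNeg (g.symm w) :=
  Equiv.sum_comp f.symm fun b => T.weight b (g.symm w)

end Transport

/-! ### Classes of labeled trees and trees on fixed vertices. -/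

section Classes

variable {S : Type} {Ξ : LabeledPassport S} {q p : ℕ}

/-- The class of a tree with a fixed labeling. -/
def treeClassOf (hq : ∀ x ∈ Ξ.pos, (x.1 : ℕ) = q) (hp : ∀ x ∈ Ξ.neg, (x.1 : ℕ) = p)
    {lp : Fin (Multiset.card Ξ.pos) → ℕ+ × S} {ln : Fin (Multiset.card Ξ.neg) → ℕ+ × S}
    (hlp : Finset.univ.val.map lp = Ξ.pos) (hln : Finset.univ.val.map ln = Ξ.neg)
    (T : ConstWeightTree (Fin (Multiset.card Ξ.pos)) (Fin (Multiset.card Ξ.neg)) q p) :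
    TreeClass Ξ :=
  Quotient.mk _
    { toWBPTree := T.1
      labPos := lp
      labNeg := ln
      labPos_bij := hlp
      labNeg_bij := hln
      labPos_wt := fun b => by
        rw [T.2.1 b]
        exact hq _ (hlp ▸ Multiset.mem_map_of_mem lp (Finset.mem_univ b))
      labNeg_wt := fun w => by
        rw [T.2.2 w]
        exact hp _ (hln ▸ Multiset.mem_map_of_mem ln (Finset.mem_univ w)) }

variable (hq : ∀ x ∈ Ξ.pos, (x.1 : ℕ) = q) (hp : ∀ x ∈ Ξ.neg, (x.1 : ℕ) = p)
  {lp : Fin (Multiset.card Ξ.pos) → ℕ+ × S} {ln : Fin (Multiset.card Ξ.neg) → ℕ+ × S}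
  (hlp : Finset.univ.val.map lp = Ξ.pos) (hln : Finset.univ.val.map ln = Ξ.neg)

/-- An isomorphism preserving pairwise distinct labels fixes every vertex, so it is an equality. -/
theorem treeClassOf_injective (hpos : Ξ.pos.Nodup) (hneg : Ξ.neg.Nodup) :
    Function.Injective (treeClassOf hq hp hlp hln) := by
  intro T T' h
  obtain ⟨φ, f, g, hf, hg, hr, hw, hlabp, hlabn⟩ := Quotient.exact h
  have hf1 : ∀ b, f b = b := fun b => injective_of_map_nodup hpos hlp (hlabp b)
  have hg1 : ∀ w, g w = w := fun w => injective_of_map_nodup hneg hln (hlabn w)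
  have hφ : ∀ v, φ v = v := by
    rintro (b | w)
    · rw [hf, hf1]
    · rw [hg, hg1]
  apply Subtype.ext
  apply WBPTree.ext_of_rot
  · funext b w
    have := hw b w
    rw [hf1, hg1] at this
    exact this.symm
  · intro v u u' huu'
    have h1 := congrArg Subtype.val (hr v u)
    exact (h1.trans (hφ _)).symm.trans (WBPTree.rot_congr T'.1 (hφ v) ((hφ u).trans huu'))

/-- Transport along the bijections matching the labels turns any labeling into the fixed one; the
prescribed weights survive because they are constant on each color. -/
theorem treeClassOf_surjective (hpos : Ξ.pos.Nodup) (hneg : Ξ.neg.Nodup) :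
    Function.Surjective (treeClassOf hq hp hlp hln) := by
  intro c
  obtain ⟨T, rfl⟩ := Quotient.exists_rep c
  obtain ⟨f, hf⟩ := exists_relabeling hpos T.labPos_bij hlp
  obtain ⟨g, hg⟩ := exists_relabeling hneg T.labNeg_bij hln
  have hTq : ∀ b, T.wtPos b = q := by
    intro b
    rw [← T.labPos_wt b]
    have hmem := Multiset.mem_map_of_mem T.labPos (Finset.mem_val.mpr (Finset.mem_univ b))
    rw [T.labPos_bij] at hmem
    exact hq _ hmem
  have hTp : ∀ w, T.wtNeg w = p := by
    intro w
    rw [← T.labNeg_wt w]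
    have hmem := Multiset.mem_map_of_mem T.labNeg (Finset.mem_val.mpr (Finset.mem_univ w))
    rw [T.labNeg_bij] at hmem
    exact hp _ hmem
  refine ⟨⟨T.toWBPTree.transport f g, ?_, ?_⟩, ?_⟩
  · intro b; rw [WBPTree.transport_wtPos, hTq]
  · intro w; rw [WBPTree.transport_wtNeg, hTp]
  · refine Quotient.sound (LWBPTree.Same.symm ?_)
    have hs : ∀ v, (Equiv.sumCongr f g).symm (Equiv.sumCongr f g v) = v :=
      (Equiv.sumCongr f g).symm_apply_apply
    refine ⟨(SimpleGraph.Iso.comap (Equiv.sumCongr f g).symm T.graph).symm, f, g,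
      fun b => rfl, fun w => rfl, ?_, ?_, hf, hg⟩
    · intro v u
      apply Subtype.ext
      refine congrArg (Equiv.sumCongr f g) ?_
      exact WBPTree.rot_congr T.toWBPTree (hs v) (hs u)
    · intro b w
      change T.weight (f.symm (f b)) (g.symm (g w)) = _
      rw [Equiv.symm_apply_apply, Equiv.symm_apply_apply]

end Classes

/-! ### The filled passport of (q^p, p^q). -/

section Passport

/-- The decidability instance is arbitrary so that the lemma also matches the classical instance
inside `fillMultiset`. -/
theorem bind_toFinset_replicate {α β : Type} (_ : DecidableEq α) (n : ℕ) (hn : 0 < n) (x : α)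
    (F : α → ℕ → Multiset β) :
    ((Multiset.replicate n x).toFinset.val.bind fun y =>
      F y ((Multiset.replicate n x).count y)) = F x n := by
  rw [Multiset.toFinset_replicate, if_neg hn.ne', Finset.singleton_val,
    Multiset.singleton_bind, Multiset.count_replicate_self]

theorem prod_factorial_count_replicate {α : Type} (_ : DecidableEq α) (n : ℕ) (x : α) :
    ∏ y ∈ (Multiset.replicate n x).toFinset, ((Multiset.replicate n x).count y).factorial =
      n.factorial := by
  rw [Multiset.toFinset_replicate]
  split_ifs with h
  · rw [h]; rfl
  · rw [Finset.prod_singleton, Multiset.count_replicate_self]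

theorem fillMultiset_replicate {S : Type} (n : ℕ) (hn : 0 < n) (x : ℕ+ × S) :
    fillMultiset (Multiset.replicate n x) =
      (Finset.Icc 1 n).val.map fun s => (x.1, (x.2, s)) := by
  exact bind_toFinset_replicate _ n hn x fun y k =>
    (Finset.Icc 1 k).val.map fun s => (y.1, (y.2, s))

theorem fillMultiset_replicate_nodup {S : Type} (n : ℕ) (hn : 0 < n) (x : ℕ+ × S) :
    (fillMultiset (Multiset.replicate n x)).Nodup := by
  rw [fillMultiset_replicate n hn]
  refine Multiset.Nodup.map ?_ (Finset.Icc 1 n).nodup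
  intro s t h
  exact (Prod.mk.inj (Prod.mk.inj h).2).2

theorem card_fillMultiset_replicate {S : Type} (n : ℕ) (hn : 0 < n) (x : ℕ+ × S) :
    Multiset.card (fillMultiset (Multiset.replicate n x)) = n := by
  rw [fillMultiset_replicate n hn, Multiset.card_map, Finset.card_val, Nat.card_Icc,
    Nat.add_sub_cancel]

theorem multFactorial_pqPassport (p q : ℕ+) :
    (pqPassport p q).multFactorial = (p : ℕ).factorial * (q : ℕ).factorial := by
  exact congrArg₂ (· * ·) (prod_factorial_count_replicate _ p (q, 0))
    (prod_factorial_count_replicate _ q (p, 0))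

end Passport

/-! ### Assembly of the count and the closed form. -/

theorem proposition4p6 (p q : ℕ+) (hpq : q < p) :
    Finite (FTree (pqPassport p q)) ∧
      GOne (pqPassport p q) = ∑ n ∈ typesOne (Nat.gcd p q), COne p q n := by
  classical
  have hp0 : 0 < (p : ℕ) := p.pos
  have hq0 : 0 < (q : ℕ) := q.pos
  set Ξ := (pqPassport p q).fill with hΞ
  have hpos : Ξ.pos = fillMultiset (Multiset.replicate (p : ℕ) (q, 0)) := rfl
  have hneg : Ξ.neg = fillMultiset (Multiset.replicate (q : ℕ) (p, 0)) := rfl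
  have hposn : Ξ.pos.Nodup := fillMultiset_replicate_nodup _ hp0 _
  have hnegn : Ξ.neg.Nodup := fillMultiset_replicate_nodup _ hq0 _
  have hcp : Multiset.card Ξ.pos = p := card_fillMultiset_replicate _ hp0 _
  have hcn : Multiset.card Ξ.neg = q := card_fillMultiset_replicate _ hq0 _
  have hwp : ∀ x ∈ Ξ.pos, (x.1 : ℕ) = q := by
    intro x hx
    rw [hpos, fillMultiset_replicate _ hp0] at hx
    obtain ⟨s, _, rfl⟩ := Multiset.mem_map.mp hx
    rfl
  have hwn : ∀ x ∈ Ξ.neg, (x.1 : ℕ) = p := by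
    intro x hx
    rw [hneg, fillMultiset_replicate _ hq0] at hx
    obtain ⟨s, _, rfl⟩ := Multiset.mem_map.mp hx
    rfl
  obtain ⟨lp, hlp⟩ := exists_labeling Ξ.pos
  obtain ⟨ln, hln⟩ := exists_labeling Ξ.neg
  have hbij : Function.Bijective (treeClassOf hwp hwn hlp hln) :=
    ⟨treeClassOf_injective _ _ _ _ hposn hnegn, treeClassOf_surjective _ _ _ _ hposn hnegn⟩
  set P := Fin (Multiset.card Ξ.pos)
  set N := Fin (Multiset.card Ξ.neg)
  have hP : Fintype.card P = p := by rw [Fintype.card_fin, hcp]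
  have hN : Fintype.card N = q := by rw [Fintype.card_fin, hcn]
  have hbal : Fintype.card P * (q : ℕ) = Fintype.card N * (p : ℕ) := by rw [hP, hN, mul_comm]
  have r : P ⊕ N := Sum.inl ⟨0, by rw [hcp]; exact hp0⟩
  obtain ⟨hfin, hcard⟩ := card_constWeightTree (P := P) (N := N) q p hbal r
  have hV : Fintype.card (P ⊕ N) = p + q := by rw [Fintype.card_sum, hP, hN]
  have hplanted := plantedCount_of_balanced (excess_univ (P := P) (N := N) q p hbal)
    (by rw [hV]; omega) r
  -- The edge-rooted count is now p+q-1 times the number of classes. The closed form of the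
  -- coefficient carries the same factor, which cancels at the end.
  rw [← hcard, Nat.card_congr (Equiv.ofBijective _ hbij), hV] at hplanted
  have hcoeff := plantedCount_eq_plantedCoeff (σ := Sum.isLeft) hp0 hq0
    (a := vertexWeight (q : ℕ) (p : ℕ)) (fun v => rfl) (Finset.univ : Finset (P ⊕ N))
  have htype : colorType Sum.isLeft (Finset.univ : Finset (P ⊕ N)) =
      Finsupp.single 0 (p : ℕ) + Finsupp.single 1 (q : ℕ) := by
    rw [colorType]
    congr 2
    · rw [← hP, Finset.card_filter, Fintype.sum_sum_type]; simp
    · rw [← hN, Finset.card_filter, Fintype.sum_sum_type]; simp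
  rw [hplanted, htype, plantedCoeff_eq_sum p q hp0 hq0] at hcoeff
  refine ⟨Finite.of_surjective _ hbij.2, ?_⟩
  rw [GOne, multFactorial_pqPassport]
  have h1 : (((p : ℕ) + (q : ℕ) - 1 : ℕ) : ℚ) = ((p : ℕ) : ℚ) + (q : ℕ) - 1 := by
    rw [Nat.cast_sub (by omega)]; push_cast; ring
  have h2 : ((p : ℕ) : ℚ) + (q : ℕ) - 1 ≠ 0 := by
    rw [← h1, Nat.cast_ne_zero]; omega
  rw [Nat.cast_mul, h1] at hcoeff
  have h3 : (((p : ℕ).factorial : ℚ) * ((q : ℕ).factorial : ℚ)) ≠ 0 := by positivity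
  rw [Nat.cast_mul, div_eq_iff h3]
  apply mul_left_cancel₀ h2
  change (((p : ℕ) : ℚ) + (q : ℕ) - 1) * (Nat.card (TreeClass Ξ) : ℚ) = _
  rw [hcoeff]
  simp
  ring
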